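/- Let $k$ be a field, $A=k[\epsilon]/(\epsilon^2)$ the ring of dual numbers, and $D^b(A)$ the bounded derived category of the abelian category of finitely generated $A$-modules. Let $\operatorname{Stab}(D^b(A))$ be the set of locally finite Bridgeland stability conditions $(Z,\mathscr P)$ on $D^b(A)$, where $Z:K(D^b(A))\to\mathbb C$ is the central charge and $\mathscr P(\phi)$, $\phi\in\mathbb R$, are the (replete, full, additive) subcategories of semistable objects of phase $\phi$. Give it the topology of Bridgeland's generalized metric $$d(\sigma,\tau)=\sup_{E\neq 0}\max\Big\{|\phi^-_\sigma(E)-\phi^-_\tau(E)|,\ |\phi^+_\sigma(E)-\phi^+_\tau(E)|,\ \Big|\log\tfrac{m_\sigma(E)}{m_\tau(E)}\Big|\Big\},$$ where $\phi^{+}(E)$, $\phi^-(E)$ are the largest and the smallest phase of a Harder–Narasimhan factor of $E$ and $m(E)$ is the sum of the $|Z(A_j)|$ over the Harder–Narasimhan factors $A_j$ of $E$. Let $\widetilde{\mathrm{GL}}{}^+(2,\mathbb R)$ be the universal cover of $\mathrm{GL}^+(2,\mathbb R)$, that is, the group of pairs $(G,f)$ with $G\in\mathrm{GL}^+(2,\mathbb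 R)$ and $f:\mathbb R\to\mathbb R$ an increasing bijection such that $f(x+1)=f(x)+1$ and $G e^{i\pi\phi}\in\mathbb R_{>0}\,e^{i\pi f(\phi)}$ for all $\phi$; it acts on stability conditions from the right by $(Z,\mathscr P)\cdot(G,f)=(G^{-1}\circ Z,\ \phi\mapsto\mathscr P(f(\phi)))$. Let $S$ be its subgroup generated by the rotations $(e^{i\pi\theta},x\mapsto x+\theta)$, $\theta\in\mathbb R$, and the scalings $(r,x\mapsto x)$, $r>0$. Then: 1. $S$ acts freely and transitively on $\operatorname{Stab}(D^b(A))$, which is not empty. 2. $\operatorname{Hom}(K(D^b(A)),\mathbb C)$ is one-dimensional, the map $(Z,\mathscr P)\mapsto Z$ makes $\operatorname{Stab}(D^b(A))$ a complex manifold (with charts the restrictions of this map to suitable open sets), and this complex manifold is isomorphic (biholomorphic) to $\mathbb C$. 3. $\mathbb C$ is the universal cover of $\mathbb C^*$: it is simply connected and $\exp:\mathbb C\to\mathbb C^*$ is a covering map. The biholomorphism $\Psi:\operatorname{Stab}(D^b(A))\to\mathbb C$ and a linear isomorphism $L:\operatorname{Hom}(K(D^b(A)),\mathbb C)\to\mathbb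 C$ can be chosen so that $\exp(\Psi(Z,\mathscr P))=L(Z)$ for all $(Z,\mathscr P)$. -/

import Mathlib

open CategoryTheory CategoryTheory.Limits CategoryTheory.Pretriangulated
open scoped Manifold ContDiff DualNumber ENNReal

universe w u v

namespace Bridgeland

/-! ### The Grothendieck group of a triangulated category -/

section Grothendieck

variable (T : Type u) [Category.{v} T] [Preadditive T] [HasZeroObject T] [HasShift T ℤ]
  [∀ n : ℤ, (shiftFunctor T n).Additive] [Pretriangulated T]

/-- The Grothendieck group of a triangulated category: the free abelian group on its objects,
modulo `[Y] = [X] + [Z]` for every distinguished triangle `X ⟶ Y ⟶ Z ⟶ X⟦1⟧`. -/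
def K₀ : Type u :=
  FreeAbelianGroup T ⧸ AddSubgroup.closure
    {x : FreeAbelianGroup T | ∃ t ∈ distTriang T,
      x = FreeAbelianGroup.of t.obj₂ - (FreeAbelianGroup.of t.obj₁ + FreeAbelianGroup.of t.obj₃)}

instance : AddCommGroup (K₀ T) :=
  inferInstanceAs (AddCommGroup (FreeAbelianGroup T ⧸ AddSubgroup.closure
    {x : FreeAbelianGroup T | ∃ t ∈ distTriang T,
      x = FreeAbelianGroup.of t.obj₂ - (FreeAbelianGroup.of t.obj₁ + FreeAbelianGroup.of t.obj₃)}))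

variable {T}

/-- The class `[E]` of an object in the Grothendieck group. -/
def K₀.of (E : T) : K₀ T := QuotientAddGroup.mk (FreeAbelianGroup.of E)

end Grothendieck

/-! ### Stability conditions -/

section Stability

variable {T : Type u} [Category.{v} T] [Preadditive T] [HasZeroObject T] [HasShift T ℤ]
  [∀ n : ℤ, (shiftFunctor T n).Additive] [Pretriangulated T]

/-- A Harder-Narasimhan filtration `0 = E₀ ⟶ E₁ ⟶ ⋯ ⟶ Eₙ₊₁ ≅ E` (with `n + 1 ≥ 1` steps) of an
object `E`: the cone of each step is a nonzero object of `P φⱼ`, and `φ₀ > φ₁ > ⋯ > φₙ`. -/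
structure HNFiltration (P : ℝ → ObjectProperty T) (E : T) where
  /-- one less than the number of steps -/
  n : ℕ
  /-- the objects of the filtration -/
  obj : Fin (n + 2) → T
  /-- the semistable factors -/
  factor : Fin (n + 1) → T
  /-- the phases of the factors -/
  phase : Fin (n + 1) → ℝ
  /-- the steps of the filtration -/
  incl : ∀ j : Fin (n + 1), obj j.castSucc ⟶ obj j.succ
  /-- the projections to the factors -/
  proj : ∀ j : Fin (n + 1), obj j.succ ⟶ factor j
  /-- the connecting morphisms -/
  conn : ∀ j : Fin (n + 1), factor j ⟶ (obj j.castSucc)⟦(1 : ℤ)⟧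
  distinguished : ∀ j : Fin (n + 1), Triangle.mk (incl j) (proj j) (conn j) ∈ distTriang T
  isZero_bot : IsZero (obj 0)
  /-- the last object is `E` -/
  top : obj (Fin.last (n + 1)) ≅ E
  semistable : ∀ j, P (phase j) (factor j)
  factor_ne_zero : ∀ j, ¬ IsZero (factor j)
  strictAnti : StrictAnti phase

variable (T) in
/-- A stability condition `(Z, P)` on a triangulated category: a central charge `Z` and full
additive (replete) subcategories `P φ`, `φ ∈ ℝ`. -/
@[ext]
structure StabilityCondition where
  /-- the central charge -/
  Z : K₀ T →+ ℂ
  /-- the subcategories `P φ` -/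
  P : ℝ → ObjectProperty T
  closedUnderIso : ∀ φ, (P φ).IsClosedUnderIsomorphisms
  containsZero : ∀ φ, (P φ).ContainsZero
  closedUnderSums : ∀ φ, (P φ).IsClosedUnderBinaryProducts
  /-- a nonzero object of `P φ` has phase `φ` -/
  phase_eq : ∀ φ E, P φ E → ¬ IsZero E →
    ∃ m : ℝ, 0 < m ∧ Z (K₀.of E) = m * Complex.exp (Real.pi * φ * Complex.I)
  /-- `P (φ + 1) = (P φ)[1]` -/
  shift_iff : ∀ φ E, P (φ + 1) (E⟦(1 : ℤ)⟧) ↔ P φ E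
  hom_eq_zero : ∀ φ₁ φ₂, φ₂ < φ₁ → ∀ E₁ E₂, P φ₁ E₁ → P φ₂ E₂ → ∀ f : E₁ ⟶ E₂, f = 0
  exists_hn : ∀ E, ¬ IsZero E → Nonempty (HNFiltration P E)

/-- The smallest full subcategory that contains the zero objects and the objects of `Q` and is
closed under extensions (and isomorphisms). -/
inductive ExtensionClosure (Q : ObjectProperty T) : T → Prop
  | of (E : T) (h : Q E) : ExtensionClosure Q E
  | zero (E : T) (h : IsZero E) : ExtensionClosure Q E
  | ext (t : Triangle T) (ht : t ∈ distTriang T) (h₁ : ExtensionClosure Q t.obj₁)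
      (h₃ : ExtensionClosure Q t.obj₃) : ExtensionClosure Q t.obj₂
  | iso (E F : T) (e : E ≅ F) (h : ExtensionClosure Q E) : ExtensionClosure Q F

/-- A (quasi-abelian) category has finite length if the strict subobjects of every object satisfy
both chain conditions. A monomorphism is strict if it is a kernel; in a preadditive category this
means that it is an equalizer, that is, a regular monomorphism. -/
def IsFiniteLength (C : Type*) [Category C] : Prop :=
  ∀ X : C, WellFoundedLT {S : Subobject X // IsRegularMono S.arrow} ∧
    WellFoundedGT {S : Subobject X // IsRegularMono S.arrow}

namespace StabilityCondition

/-- The full subcategory `P((a, b))`, the extension-closed subcategory generated by the `P φ`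
with `a < φ < b`. -/
def interval (σ : StabilityCondition T) (a b : ℝ) : ObjectProperty T :=
  ExtensionClosure (fun E ↦ ∃ φ, a < φ ∧ φ < b ∧ σ.P φ E)

/-- Local finiteness: for some small `η > 0`, all the quasi-abelian categories
`P((t - η, t + η))` have finite length. -/
def IsLocallyFinite (σ : StabilityCondition T) : Prop :=
  ∃ η : ℝ, 0 < η ∧ η < 1 / 2 ∧
    ∀ t : ℝ, IsFiniteLength (σ.interval (t - η) (t + η)).FullSubcategory

/-- The Harder-Narasimhan filtration of a nonzero object; it is unique up to isomorphism. -/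
noncomputable def hn (σ : StabilityCondition T) (E : T) (hE : ¬ IsZero E) :
    HNFiltration σ.P E := (σ.exists_hn E hE).some

/-- `φ⁺(E)`, the largest phase of a Harder-Narasimhan factor. -/
noncomputable def phiPlus (σ : StabilityCondition T) (E : T) (hE : ¬ IsZero E) : ℝ :=
  (σ.hn E hE).phase 0

/-- `φ⁻(E)`, the smallest phase of a Harder-Narasimhan factor. -/
noncomputable def phiMinus (σ : StabilityCondition T) (E : T) (hE : ¬ IsZero E) : ℝ :=
  (σ.hn E hE).phase (Fin.last _)

/-- The mass `m(E) = ∑ |Z(Aⱼ)|`, the sum over the Harder-Narasimhan factors `Aⱼ` of `E`. -/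
noncomputable def mass (σ : StabilityCondition T) (E : T) (hE : ¬ IsZero E) : ℝ :=
  ∑ j, ‖σ.Z (K₀.of ((σ.hn E hE).factor j))‖

/-- The generalized metric
`d(σ, τ) = sup_{E ≠ 0} max (|φ⁻_σ E - φ⁻_τ E|, |φ⁺_σ E - φ⁺_τ E|, |log (m_σ E / m_τ E)|)`,
with values in `[0, ∞]`. -/
noncomputable instance : PseudoEMetricSpace (StabilityCondition T) where
  edist σ τ := ⨆ (E : T) (hE : ¬ IsZero E),
    max (edist (σ.phiMinus E hE) (τ.phiMinus E hE))
      (max (edist (σ.phiPlus E hE) (τ.phiPlus E hE))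
        (edist (Real.log (σ.mass E hE)) (Real.log (τ.mass E hE))))
  edist_self σ := by simp
  edist_comm σ τ := by simp only [edist_comm]
  edist_triangle σ τ ρ := by
    refine iSup₂_le fun E hE ↦ ?_
    refine le_trans ?_ (add_le_add (le_iSup₂ (f := fun (E : T) (hE : ¬ IsZero E) ↦
      max (edist (σ.phiMinus E hE) (τ.phiMinus E hE))
        (max (edist (σ.phiPlus E hE) (τ.phiPlus E hE))
          (edist (Real.log (σ.mass E hE)) (Real.log (τ.mass E hE))))) E hE)
      (le_iSup₂ (f := fun (E : T) (hE : ¬ IsZero E) ↦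
      max (edist (τ.phiMinus E hE) (ρ.phiMinus E hE))
        (max (edist (τ.phiPlus E hE) (ρ.phiPlus E hE))
          (edist (Real.log (τ.mass E hE)) (Real.log (ρ.mass E hE))))) E hE))
    refine max_le ?_ (max_le ?_ ?_)
    · exact (edist_triangle _ _ _).trans
        (add_le_add (le_max_left _ _) (le_max_left _ _))
    · exact (edist_triangle _ _ _).trans
        (add_le_add (le_max_of_le_right (le_max_left _ _))
          (le_max_of_le_right (le_max_left _ _)))
    · exact (edist_triangle _ _ _).trans
        (add_le_add (le_max_of_le_right (le_max_right _ _))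
          (le_max_of_le_right (le_max_right _ _)))

end StabilityCondition

variable (T) in
/-- The space of locally finite stability conditions, with the topology of the generalized
metric. -/
abbrev Stab : Type u := {σ : StabilityCondition T // σ.IsLocallyFinite}

/-- The complex structure of `Stab T`, relative to a linear coordinate `L` on the vector space
`Hom(K₀ T, ℂ)`: every chart is the restriction of the map `σ ↦ Z_σ` to an open subset, read in the
coordinate `L`. -/
def IsCentralChargeAtlas {V : Type*} [NormedAddCommGroup V] [NormedSpace ℂ V]
    (L : (K₀ T →+ ℂ) ≃ₗ[ℂ] V) (cs : ChartedSpace V (Stab T)) : Prop :=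
  ∀ e ∈ cs.atlas, ∀ σ ∈ e.source, e σ = L σ.1.Z

end Stability

/-! ### The universal cover of `GL⁺(2, ℝ)` and its action -/

/-- The universal cover of `GL⁺(2, ℝ)`, with `ℝ²` identified with `ℂ`: pairs `(G, f)` where `G` is
an orientation preserving linear automorphism of the plane and `f` an increasing bijection of `ℝ`
with `f (x + 1) = f x + 1` that lifts the map induced by `G` on directions. -/
noncomputable def GLTilde : Subgroup ((ℂ ≃ₗ[ℝ] ℂ) × (ℝ ≃o ℝ)) where
  carrier := {g | 0 < LinearMap.det (g.1 : ℂ →ₗ[ℝ] ℂ) ∧ (∀ x, g.2 (x + 1) = g.2 x + 1) ∧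
    ∀ φ : ℝ, ∃ r : ℝ, 0 < r ∧
      g.1 (Complex.exp (Real.pi * φ * Complex.I)) =
        r * Complex.exp (Real.pi * g.2 φ * Complex.I)}
  mul_mem' := by
    rintro ⟨G, f⟩ ⟨G', f'⟩ ⟨h₁, h₂, h₃⟩ ⟨h₁', h₂', h₃'⟩
    refine ⟨?_, fun x ↦ ?_, fun φ ↦ ?_⟩
    · have : ((G * G' : ℂ ≃ₗ[ℝ] ℂ) : ℂ →ₗ[ℝ] ℂ) = (G : ℂ →ₗ[ℝ] ℂ) ∘ₗ (G' : ℂ →ₗ[ℝ] ℂ) := rfl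
      change 0 < LinearMap.det ((G * G' : ℂ ≃ₗ[ℝ] ℂ) : ℂ →ₗ[ℝ] ℂ)
      rw [this, LinearMap.det_comp]
      exact mul_pos h₁ h₁'
    · simp only [Prod.mk_mul_mk, RelIso.mul_apply] at *
      rw [h₂', h₂]
    · obtain ⟨r', hr', e'⟩ := h₃' φ
      obtain ⟨r, hr, e⟩ := h₃ (f' φ)
      refine ⟨r' * r, mul_pos hr' hr, ?_⟩
      simp only [Prod.mk_mul_mk, RelIso.mul_apply, LinearEquiv.mul_apply] at *
      rw [e', ← Complex.real_smul, map_smul, e, Complex.real_smul]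
      push_cast
      ring
  one_mem' := by
    refine ⟨by simp, fun x ↦ rfl, fun φ ↦ ⟨1, one_pos, by simp⟩⟩
  inv_mem' := by
    rintro ⟨G, f⟩ ⟨h₁, h₂, h₃⟩
    refine ⟨?_, fun x ↦ ?_, fun φ ↦ ?_⟩
    · have h := LinearEquiv.det_mul_det_symm G
      by_contra hn
      have h' : LinearMap.det (G.symm : ℂ →ₗ[ℝ] ℂ) ≤ 0 := not_lt.mp hn
      have := mul_nonpos_of_nonneg_of_nonpos h₁.le h'
      linarith
    · apply f.injective
      change f (f.symm (x + 1)) = f (f.symm x + 1)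
      rw [show f (f.symm x + 1) = f (f.symm x) + 1 from h₂ _]
      simp
    · obtain ⟨r, hr, e⟩ := h₃ (f.symm φ)
      refine ⟨r⁻¹, inv_pos.mpr hr, ?_⟩
      change G.symm _ = _ * Complex.exp (Real.pi * (f.symm φ : ℝ) * Complex.I)
      rw [LinearEquiv.symm_apply_eq, ← Complex.real_smul (x := r⁻¹), map_smul]
      simp only at e
      rw [e, Complex.real_smul]
      simp [hr.ne']

/-- The subgroup generated by the rotations `(exp(iπθ), x ↦ x + θ)`, `θ ∈ ℝ`, and the scalings
`(k, x ↦ x)`, `k > 0`. -/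
noncomputable def rotationsScalings : Subgroup GLTilde :=
  Subgroup.closure
    ({g | ∃ θ : ℝ, (∀ z, g.1.1 z = Complex.exp (Real.pi * θ * Complex.I) * z) ∧
        ∀ x, g.1.2 x = x + θ} ∪
      {g | ∃ k : ℝ, 0 < k ∧ (∀ z, g.1.1 z = k * z) ∧ ∀ x, g.1.2 x = x})

lemma rotationsScalings_translation {g : GLTilde} (hg : g ∈ rotationsScalings) :
    ∃ θ : ℝ, ∀ x, g.1.2 x = x + θ := by
  induction hg using Subgroup.closure_induction with
  | mem g hg =>
    rcases hg with ⟨θ, -, h⟩ | ⟨k, -, -, h⟩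
    · exact ⟨θ, h⟩
    · exact ⟨0, fun x ↦ by simp [h]⟩
  | one => exact ⟨0, fun x ↦ by simp⟩
  | mul a b _ _ ha hb =>
    obtain ⟨θ, h⟩ := ha
    obtain ⟨θ', h'⟩ := hb
    refine ⟨θ' + θ, fun x ↦ ?_⟩
    change a.1.2 (b.1.2 x) = _
    rw [h', h, add_assoc]
  | inv a _ ha =>
    obtain ⟨θ, h⟩ := ha
    refine ⟨-θ, fun x ↦ ?_⟩
    change a.1.2.symm x = _
    rw [OrderIso.symm_apply_eq, h]
    ring

section Action

variable {T : Type u} [Category.{v} T] [Preadditive T] [HasZeroObject T] [HasShift T ℤ]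
  [∀ n : ℤ, (shiftFunctor T n).Additive] [Pretriangulated T]

/-- The right action `(Z, P) · (G, f) = (G⁻¹ ∘ Z, φ ↦ P (f φ))`. -/
noncomputable def StabilityCondition.act (σ : StabilityCondition T) (g : GLTilde) :
    StabilityCondition T where
  Z := (g.1.1.symm : ℂ →+ ℂ).comp σ.Z
  P φ := σ.P (g.1.2 φ)
  closedUnderIso φ := σ.closedUnderIso _
  containsZero φ := σ.containsZero _
  closedUnderSums φ := σ.closedUnderSums _
  phase_eq φ E hE h0 := by
    obtain ⟨m, hm, e⟩ := σ.phase_eq _ E hE h0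
    obtain ⟨r, hr, e'⟩ := g.2.2.2 φ
    refine ⟨m / r, div_pos hm hr, ?_⟩
    change g.1.1.symm (σ.Z (K₀.of E)) = _
    rw [LinearEquiv.symm_apply_eq, ← Complex.real_smul (x := m / r), map_smul, e', e, Complex.real_smul]
    have : (r : ℂ) ≠ 0 := by exact_mod_cast hr.ne'
    push_cast
    field_simp
  shift_iff φ E := by
    rw [g.2.2.1 φ]
    exact σ.shift_iff _ E
  hom_eq_zero φ₁ φ₂ h := σ.hom_eq_zero _ _ (g.1.2.strictMono h)
  exists_hn E hE := by
    obtain ⟨F⟩ := σ.exists_hn E hE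
    exact ⟨{ n := F.n, obj := F.obj, factor := F.factor
             phase := fun j ↦ g.1.2.symm (F.phase j)
             incl := F.incl, proj := F.proj, conn := F.conn
             distinguished := F.distinguished
             isZero_bot := F.isZero_bot
             top := F.top
             semistable := fun j ↦ by simpa using F.semistable j
             factor_ne_zero := F.factor_ne_zero
             strictAnti := fun i j h ↦ g.1.2.symm.strictMono (F.strictAnti h) }⟩

noncomputable instance : MulAction GLTildeᵐᵒᵖ (StabilityCondition T) where
  smul g σ := σ.act g.unop
  one_smul _ := rfl
  mul_smul _ _ _ := rfl

lemma StabilityCondition.isLocallyFinite_act {σ : StabilityCondition T} (hσ : σ.IsLocallyFinite)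
    {g : GLTilde} (hg : g ∈ rotationsScalings) : (σ.act g).IsLocallyFinite := by
  obtain ⟨η, hη, hη', h⟩ := hσ
  obtain ⟨θ, hθ⟩ := rotationsScalings_translation hg
  refine ⟨η, hη, hη', fun t ↦ ?_⟩
  have : (σ.act g).interval (t - η) (t + η) = σ.interval (t + θ - η) (t + θ + η) := by
    unfold StabilityCondition.interval
    congr 1
    funext E
    apply propext
    constructor
    · rintro ⟨φ, h₁, h₂, h₃⟩
      exact ⟨φ + θ, by linarith, by linarith, by simpa [StabilityCondition.act, hθ] using h₃⟩
    · rintro ⟨φ, h₁, h₂, h₃⟩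
      exact ⟨φ - θ, by linarith, by linarith, by simpa [StabilityCondition.act, hθ] using h₃⟩
  rw [this]
  exact h _

/-- The right action of the group of rotations and scalings on `Stab T`. -/
noncomputable instance : MulAction rotationsScalingsᵐᵒᵖ (Stab T) where
  smul g σ := ⟨σ.1.act g.unop.1, StabilityCondition.isLocallyFinite_act σ.2 g.unop.2⟩
  one_smul _ := rfl
  mul_smul _ _ _ := rfl

end Action

/-! ### The bounded derived category of the dual numbers -/

instance {k : Type u} [Field k] : IsNoetherianRing (DualNumber k) :=
  have : Module.Finite k (DualNumber k) := inferInstanceAs (Module.Finite k (k × k))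
  IsNoetherianRing.of_finite k (DualNumber k)

/-- The bounded derived category of the category of finitely generated modules over the ring
`A = k[ε]/(ε²)` of dual numbers. -/
abbrev DbDual (k : Type u) [Field k] [HasDerivedCategory.{w} (FGModuleCat.{u} (DualNumber k))] :
    Type _ :=
  DerivedCategory.Bounded (FGModuleCat.{u} (DualNumber k))

end Bridgeland

/-!
The bounded derived category of the dual numbers has a single simple object `k` in its standard
heart, and every nonzero module has `k` both as a submodule and as a quotient. Only this property
matters, so the arguments apply to any abelian category with the structure `LocalLength`.

Let `E` and `F` be semistable of phases `φ` and `φ'`, let `q` be the highest degree of cohomology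
of `E`, and `r` the lowest degree of cohomology of `F`. The composition
`E ⟶ k⟦-q⟧ ⟶ F⟦r - q⟧` is nonzero, as it induces in cohomology of degree `q` an epimorphism
followed by a monomorphism; hence `φ + q ≤ φ' + r` (`LocalLength.phase_le`). For `E = F` this says
that a semistable object has cohomology in a single degree, and exchanging `E` and `F` one sees
that the sum `ψ` of this degree and of the phase is the same for all semistable objects. The factors
of a Harder-Narasimhan filtration then live in increasing cohomological degrees, so that their
cohomology adds up to that of the filtered object (`HNFiltration.len_coh_eq_sum`). It follows that
the slicing consists of the shifts of the standard heart, placed at the phases `ψ + ℤ`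
(`LocalLength.exists_eq_stdSlice`).

The Grothendieck group is generated by the class of `k`, and it is infinite cyclic because of the
Euler characteristic (`LocalLength.K₀_of_eq`, `LocalLength.eulerHom`). A central charge is therefore
given by the number `Z(k) = m exp(iπψ)`, and a stability condition by `w = log m + iπψ ∈ ℂ`
(`LocalLength.stdStability`). For two parameters the phases of an object differ by a constant, and
its masses by a constant factor, so the generalized metric is equivalent to the distance of `ℂ`
(`LocalLength.edist_stdStab`), and `w` is a global coordinate in which the central charge is the
exponential map. The rotations and the scalings form a copy of `ℂ` that acts by translations of `w`
(`LocalLength.smul_stdStab`).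
-/

namespace Bridgeland

/-! ### Cohomology on the bounded derived category -/

section Cohomology

variable {C : Type u} [Category.{v} C] [Abelian C] [HasDerivedCategory.{w} C]

/-- The `n`-th cohomology functor `Hⁿ` on the bounded derived category. -/
noncomputable def coh (n : ℤ) : DerivedCategory.Bounded C ⥤ C :=
  DerivedCategory.Bounded.ι ⋙ DerivedCategory.homologyFunctor C n

instance (n : ℤ) : (coh (C := C) n).PreservesZeroMorphisms := by
  unfold coh; infer_instance

variable (C) in
/-- The standard t-structure on the bounded derived category. -/
noncomputable abbrev tBounded :
    Triangulated.TStructure (DerivedCategory.Bounded C) :=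
  DerivedCategory.TStructure.t.bounded.tStructure DerivedCategory.TStructure.t

lemma tBounded_isLE_iff (X : DerivedCategory.Bounded C) (n : ℤ) :
    (tBounded C).IsLE X n ↔ ∀ i, n < i → IsZero ((coh i).obj X) := by
  rw [ObjectProperty.tStructure_isLE_iff]
  exact DerivedCategory.isLE_iff _ _

lemma tBounded_isGE_iff (X : DerivedCategory.Bounded C) (n : ℤ) :
    (tBounded C).IsGE X n ↔ ∀ i, i < n → IsZero ((coh i).obj X) := by
  rw [ObjectProperty.tStructure_isGE_iff]
  exact DerivedCategory.isGE_iff _ _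

lemma exists_coh_bounds (X : DerivedCategory.Bounded C) :
    ∃ a b : ℤ, ∀ i, ¬ IsZero ((coh i).obj X) → a ≤ i ∧ i ≤ b := by
  obtain ⟨⟨a, ha⟩, ⟨b, hb⟩⟩ := X.property
  rw [← ObjectProperty.tStructure_isGE_iff (P := DerivedCategory.TStructure.t.bounded),
    tBounded_isGE_iff] at ha
  rw [← ObjectProperty.tStructure_isLE_iff (P := DerivedCategory.TStructure.t.bounded),
    tBounded_isLE_iff] at hb
  refine ⟨a, b, fun i hi ↦ ⟨?_, ?_⟩⟩
  · by_contra h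
    exact hi (ha i (by lia))
  · by_contra h
    exact hi (hb i (by lia))

/-- The degrees in which the cohomology of an object does not vanish. -/
def cohSupport (X : DerivedCategory.Bounded C) : Set ℤ := {i | ¬ IsZero ((coh i).obj X)}

lemma finite_cohSupport (X : DerivedCategory.Bounded C) : (cohSupport X).Finite := by
  obtain ⟨a, b, h⟩ := exists_coh_bounds X
  exact (Set.finite_Icc a b).subset fun i hi ↦ h i hi

lemma isZero_iff_coh (X : DerivedCategory.Bounded C) :
    IsZero X ↔ ∀ i, IsZero ((coh i).obj X) := by
  refine ⟨fun h i ↦ (coh i).map_isZero h, fun h ↦ ?_⟩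
  have := (tBounded_isLE_iff X 0).2 fun i _ ↦ h i
  have := (tBounded_isGE_iff X 1).2 fun i _ ↦ h i
  exact (tBounded C).isZero X 0 1

lemma nonempty_cohSupport {X : DerivedCategory.Bounded C} (hX : ¬ IsZero X) :
    (cohSupport X).Nonempty := by
  rw [isZero_iff_coh] at hX
  push Not at hX
  exact hX

/-- `Hⁿ(X⟦a⟧) ≅ Hᵐ(X)` for `m = a + n`. -/
noncomputable def cohShiftIso (X : DerivedCategory.Bounded C) (a n m : ℤ) (h : a + n = m) :
    (coh n).obj (X⟦a⟧) ≅ (coh m).obj X :=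
  (DerivedCategory.homologyFunctor C n).mapIso
    ((DerivedCategory.Bounded.ι (C := C)).commShiftIso a |>.app X) ≪≫
    ((DerivedCategory.homologyFunctor C 0).shiftIso a n m h).app X.obj

/-- The connecting map `Hⁿ(Z) ⟶ Hⁿ⁺¹(X)` of a triangle `X ⟶ Y ⟶ Z ⟶ X⟦1⟧`. -/
noncomputable def cohδ (t : Triangle (DerivedCategory.Bounded C)) (n m : ℤ) (h : n + 1 = m) :
    (coh n).obj t.obj₃ ⟶ (coh m).obj t.obj₁ :=
  DerivedCategory.HomologySequence.δ (DerivedCategory.Bounded.ι.mapTriangle.obj t) n m h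

section LongExact

variable {t : Triangle (DerivedCategory.Bounded C)} (ht : t ∈ distTriang _)
include ht

lemma coh_exact₂ (n : ℤ) :
    (ShortComplex.mk ((coh n).map t.mor₁) ((coh n).map t.mor₂) (by
      rw [← Functor.map_comp, comp_distTriang_mor_zero₁₂ _ ht, Functor.map_zero])).Exact :=
  DerivedCategory.HomologySequence.exact₂ _
    (DerivedCategory.Bounded.ι.map_distinguished t ht) n

lemma coh_exact₃ (n m : ℤ) (h : n + 1 = m) :
    ∃ w, (ShortComplex.mk ((coh n).map t.mor₂) (cohδ t n m h) w).Exact :=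
  ⟨_, DerivedCategory.HomologySequence.exact₃ _
    (DerivedCategory.Bounded.ι.map_distinguished t ht) n m h⟩

lemma coh_exact₁ (n m : ℤ) (h : n + 1 = m) :
    ∃ w, (ShortComplex.mk (cohδ t n m h) ((coh m).map t.mor₁) w).Exact :=
  ⟨_, DerivedCategory.HomologySequence.exact₁ _
    (DerivedCategory.Bounded.ι.map_distinguished t ht) n m h⟩

lemma isZero_coh₂ (n : ℤ) (h₁ : IsZero ((coh n).obj t.obj₁)) (h₃ : IsZero ((coh n).obj t.obj₃)) :
    IsZero ((coh n).obj t.obj₂) :=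
  (coh_exact₂ ht n).isZero_of_both_zeros (h₁.eq_zero_of_src _) (h₃.eq_zero_of_tgt _)

lemma isZero_coh₃ (n m : ℤ) (h : n + 1 = m) (h₂ : IsZero ((coh n).obj t.obj₂))
    (h₁ : IsZero ((coh m).obj t.obj₁)) : IsZero ((coh n).obj t.obj₃) := by
  obtain ⟨w, hw⟩ := coh_exact₃ ht n m h
  exact hw.isZero_of_both_zeros (h₂.eq_zero_of_src _) (h₁.eq_zero_of_tgt _)

lemma isZero_coh₁ (n m : ℤ) (h : n + 1 = m) (h₃ : IsZero ((coh n).obj t.obj₃))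
    (h₂ : IsZero ((coh m).obj t.obj₂)) : IsZero ((coh m).obj t.obj₁) := by
  obtain ⟨w, hw⟩ := coh_exact₁ ht n m h
  exact hw.isZero_of_both_zeros (h₃.eq_zero_of_src _) (h₂.eq_zero_of_tgt _)

lemma mono_coh_mor₁ (n m : ℤ) (h : n + 1 = m) (h₃ : IsZero ((coh n).obj t.obj₃)) :
    Mono ((coh m).map t.mor₁) := by
  obtain ⟨w, hw⟩ := coh_exact₁ ht n m h
  exact hw.mono_g (h₃.eq_zero_of_src _)

lemma epi_coh_mor₂ (n m : ℤ) (h : n + 1 = m) (h₁ : IsZero ((coh m).obj t.obj₁)) :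
    Epi ((coh n).map t.mor₂) := by
  obtain ⟨w, hw⟩ := coh_exact₃ ht n m h
  exact hw.epi_f (h₁.eq_zero_of_tgt _)

end LongExact

/-- The object `M⟦-n⟧`, a complex concentrated in degree `n`, for `M` in the abelian category. -/
noncomputable def sgl (n : ℤ) : C ⥤ DerivedCategory.Bounded C :=
  DerivedCategory.TStructure.t.bounded.lift (DerivedCategory.singleFunctor C n)
    fun _ ↦ ⟨⟨n, inferInstance⟩, ⟨n, inferInstance⟩⟩

instance (n : ℤ) : (sgl (C := C) n).Full where
  map_surjective f := by
    obtain ⟨g, hg⟩ := (DerivedCategory.singleFunctor C n).map_surjective f.hom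
    exact ⟨g, ObjectProperty.hom_ext _ hg⟩

instance (n : ℤ) : (sgl (C := C) n).Faithful where
  map_injective h := (DerivedCategory.singleFunctor C n).map_injective
    (congrArg (fun f ↦ f.hom) h)

/-- `Hⁿ(M⟦-n⟧) ≅ M`, naturally in `M`. -/
noncomputable def sglCohIso (n : ℤ) : sgl n ⋙ coh n ≅ 𝟭 C :=
  DerivedCategory.singleFunctorCompHomologyFunctorIso C n

lemma isZero_coh_sgl (M : C) (n i : ℤ) (h : i ≠ n) : IsZero ((coh i).obj ((sgl n).obj M)) := by
  rcases h.lt_or_gt with h | h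
  · exact DerivedCategory.isZero_of_isGE ((DerivedCategory.singleFunctor C n).obj M) n i h
  · exact DerivedCategory.isZero_of_isLE ((DerivedCategory.singleFunctor C n).obj M) n i h

lemma exists_iso_sgl {X : DerivedCategory.Bounded C} {n : ℤ}
    (h : ∀ i, i ≠ n → IsZero ((coh i).obj X)) : ∃ M : C, Nonempty (X ≅ (sgl n).obj M) := by
  have h₁ := (tBounded_isLE_iff X n).2 fun i hi ↦ h i hi.ne'
  have h₂ := (tBounded_isGE_iff X n).2 fun i hi ↦ h i hi.ne
  rw [ObjectProperty.tStructure_isLE_iff] at h₁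
  rw [ObjectProperty.tStructure_isGE_iff] at h₂
  obtain ⟨M, ⟨e⟩⟩ := DerivedCategory.exists_iso_singleFunctor_obj_of_isGE_of_isLE X.obj n
  exact ⟨M, ⟨ObjectProperty.isoMk _ e⟩⟩

instance (n : ℤ) : (sgl (C := C) n).PreservesZeroMorphisms where
  map_zero X Y := by
    obtain ⟨f, hf⟩ := (sgl (C := C) n).map_surjective (0 : (sgl n).obj X ⟶ (sgl n).obj Y)
    have h : f = 0 := by
      have := (sglCohIso n).hom.naturality f
      dsimp at this
      rw [hf, Functor.map_zero, zero_comp] at this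
      rw [← cancel_epi ((sglCohIso n).hom.app X), ← this, comp_zero]
    rw [← h, hf]

/-- A short exact sequence in the abelian category gives a distinguished triangle. -/
lemma exists_sgl_triangle {S : ShortComplex C} (hS : S.ShortExact) :
    ∃ δ, Triangle.mk ((sgl 0).map S.f) ((sgl 0).map S.g) δ ∈
      distTriang (DerivedCategory.Bounded C) := by
  refine ⟨DerivedCategory.TStructure.t.bounded.fullyFaithfulι.preimage
    (hS.singleδ ≫ (DerivedCategory.Bounded.ι.commShiftIso (1 : ℤ)).inv.app ((sgl 0).obj S.X₁)), ?_⟩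
  change DerivedCategory.Bounded.ι.mapTriangle.obj _ ∈ distTriang _
  refine isomorphic_distinguished _ hS.singleTriangle_distinguished _ ?_
  refine Triangle.isoMk _ _ (Iso.refl _) (Iso.refl _) (Iso.refl _) ?_ ?_ ?_
  · exact (Category.comp_id _).trans (Category.id_comp _).symm
  · exact (Category.comp_id _).trans (Category.id_comp _).symm
  · have key {X Y Z : DerivedCategory C} (a : X ⟶ Y) (e : Z ≅ Y) (i : Y ⟶ Y) (hi : i = 𝟙 Y) :
        ((a ≫ e.inv) ≫ e.hom) ≫ i = 𝟙 X ≫ a := by simp [hi]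
    exact key hS.singleδ
      ((DerivedCategory.Bounded.ι.commShiftIso (1 : ℤ)).app ((sgl 0).obj S.X₁)) _
      (CategoryTheory.Functor.map_id _ _)

end Cohomology

/-! ### Length functions and the Euler characteristic -/

/-- An abelian category of finite length with a unique simple object: an additive length function
that vanishes on zero objects only, and an object `simple` of length one that is both a subobject
and a quotient of every nonzero object. -/
structure LocalLength (C : Type u) [Category.{v} C] [Abelian C] where
  /-- the simple object -/
  simple : C
  /-- the length of an object -/
  len : C → ℕ
  len_eq_add : ∀ {S : ShortComplex C}, S.ShortExact → len S.X₂ = len S.X₁ + len S.X₃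
  isZero_of_len : ∀ {M : C}, len M = 0 → IsZero M
  len_simple : len simple = 1
  exists_mono : ∀ {M : C}, ¬ IsZero M → ∃ f : simple ⟶ M, Mono f
  exists_epi : ∀ {M : C}, ¬ IsZero M → ∃ f : M ⟶ simple, Epi f

namespace LocalLength

section Abelian

variable {C : Type u} [Category.{v} C] [Abelian C] (ℓ : LocalLength C)

lemma len_of_isZero {M : C} (h : IsZero M) : ℓ.len M = 0 := by
  have : (ShortComplex.mk (𝟙 M) (0 : M ⟶ M) comp_zero).ShortExact :=
    { exact := (ShortComplex.exact_iff_epi _ rfl).2 inferInstance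
      mono_f := inferInstanceAs (Mono (𝟙 M))
      epi_g := ⟨fun _ _ _ ↦ h.eq_of_src _ _⟩ }
  have := ℓ.len_eq_add this
  dsimp at this
  lia

lemma len_eq_zero_iff {M : C} : ℓ.len M = 0 ↔ IsZero M :=
  ⟨ℓ.isZero_of_len, ℓ.len_of_isZero⟩

lemma len_add_len_cokernel {M N : C} (f : M ⟶ N) [Mono f] :
    ℓ.len N = ℓ.len M + ℓ.len (cokernel f) :=
  ℓ.len_eq_add (S := ShortComplex.mk f (cokernel.π f) (cokernel.condition f))
    { exact := ShortComplex.exact_cokernel f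
      mono_f := inferInstance
      epi_g := inferInstance }

lemma len_kernel_add_len {M N : C} (f : M ⟶ N) [Epi f] :
    ℓ.len M = ℓ.len (kernel f) + ℓ.len N :=
  ℓ.len_eq_add (S := ShortComplex.mk (kernel.ι f) f (kernel.condition f))
    { exact := ShortComplex.exact_kernel f
      mono_f := inferInstance
      epi_g := inferInstance }

lemma len_congr {M N : C} (e : M ≅ N) : ℓ.len M = ℓ.len N := by
  rw [ℓ.len_add_len_cokernel e.hom, ℓ.len_of_isZero (isZero_cokernel_of_epi e.hom), add_zero]

lemma len_le_of_mono {M N : C} (f : M ⟶ N) [Mono f] : ℓ.len M ≤ ℓ.len N := by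
  rw [ℓ.len_add_len_cokernel f]
  exact Nat.le_add_right _ _

lemma isIso_of_mono {M N : C} (f : M ⟶ N) [Mono f] (h : ℓ.len N ≤ ℓ.len M) : IsIso f := by
  have h₁ := ℓ.len_add_len_cokernel f
  have : Epi f := Preadditive.epi_of_isZero_cokernel f (ℓ.isZero_of_len (by lia))
  exact isIso_of_mono_of_epi f

lemma not_isZero_simple : ¬ IsZero ℓ.simple := fun h ↦ by
  have := ℓ.len_of_isZero h
  rw [ℓ.len_simple] at this
  exact one_ne_zero this

/-- The length of the image of a morphism, as an integer. -/
noncomputable def rk {M N : C} (f : M ⟶ N) : ℤ := ℓ.len M - ℓ.len (kernel f)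

lemma rk_of_isZero_src {M N : C} (f : M ⟶ N) (h : IsZero M) : ℓ.rk f = 0 := by
  have h₁ := ℓ.len_of_isZero h
  have h₂ := ℓ.len_le_of_mono (kernel.ι f)
  rw [rk, h₁, Nat.le_zero.1 (h₂.trans h₁.le), sub_self]

lemma len_eq_rk_add_rk {S : ShortComplex C} (hS : S.Exact) :
    (ℓ.len S.X₂ : ℤ) = ℓ.rk S.f + ℓ.rk S.g := by
  have : Epi (kernel.lift S.g S.f S.zero) := S.exact_iff_epi_kernel_lift.1 hS
  have h₁ := ℓ.len_kernel_add_len (kernel.lift S.g S.f S.zero)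
  have h₂ := ℓ.len_congr (kernelCompMono (kernel.lift S.g S.f S.zero) (kernel.ι S.g))
  rw [ℓ.len_congr (kernelIsoOfEq (kernel.lift_ι S.g S.f S.zero))] at h₂
  rw [rk, rk, h₂, h₁]
  push_cast
  ring

end Abelian

section Euler

variable {C : Type u} [Category.{v} C] [Abelian C] [HasDerivedCategory.{w} C] (ℓ : LocalLength C)

/-- The Euler characteristic `∑ (-1)ⁱ len Hⁱ(X)`. -/
noncomputable def euler (X : DerivedCategory.Bounded C) : ℤ :=
  ∑ᶠ i : ℤ, (i.negOnePow : ℤ) * ℓ.len ((coh i).obj X)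

/-- The total length `∑ len Hⁱ(X)` of the cohomology. -/
noncomputable def totalLen (X : DerivedCategory.Bounded C) : ℕ :=
  ∑ᶠ i : ℤ, ℓ.len ((coh i).obj X)

lemma finite_support_len (X : DerivedCategory.Bounded C) :
    (Function.support fun i ↦ ℓ.len ((coh i).obj X)).Finite :=
  (finite_cohSupport X).subset fun _ hi h ↦ hi (ℓ.len_of_isZero h)

lemma finite_support_euler (X : DerivedCategory.Bounded C) :
    (Function.support fun i : ℤ ↦ (i.negOnePow : ℤ) * ℓ.len ((coh i).obj X)).Finite :=
  (ℓ.finite_support_len X).subset fun i hi h ↦ hi (by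
    change ℓ.len ((coh i).obj X) = 0 at h
    simp [h])

/-- The long exact sequence makes the Euler characteristic additive: the ranks of the connecting
maps cancel in the alternating sum. -/
lemma euler_eq_add {t : Triangle (DerivedCategory.Bounded C)} (ht : t ∈ distTriang _) :
    ℓ.euler t.obj₂ = ℓ.euler t.obj₁ + ℓ.euler t.obj₃ := by
  let ρ : ℤ → ℤ := fun i ↦ (i.negOnePow : ℤ) * ℓ.rk (cohδ t i (i + 1) rfl)
  have hρ : (Function.support ρ).Finite := (finite_cohSupport t.obj₃).subset fun i hi h ↦ hi (by
    simp only [ρ]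
    rw [ℓ.rk_of_isZero_src _ h, mul_zero])
  let χ : DerivedCategory.Bounded C → ℤ → ℤ := fun X i ↦
    (i.negOnePow : ℤ) * ℓ.len ((coh i).obj X)
  have hχ (X) : (Function.support (χ X)).Finite := ℓ.finite_support_euler X
  have key (i : ℤ) : χ t.obj₂ (i + 1) + ρ (i + 1) = χ t.obj₁ (i + 1) + χ t.obj₃ (i + 1) + ρ i := by
    obtain ⟨_, h₁⟩ := coh_exact₁ ht i (i + 1) rfl
    have h₂ := coh_exact₂ ht (i + 1)
    obtain ⟨_, h₃⟩ := coh_exact₃ ht (i + 1) (i + 1 + 1) rfl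
    have e₁ := ℓ.len_eq_rk_add_rk h₁
    have e₂ := ℓ.len_eq_rk_add_rk h₂
    have e₃ := ℓ.len_eq_rk_add_rk h₃
    dsimp at e₁ e₂ e₃
    simp only [χ, ρ, e₁, e₂, e₃, Int.negOnePow_succ, Units.val_neg]
    ring
  have shift (f : ℤ → ℤ) : ∑ᶠ i, f (i + 1) = ∑ᶠ i, f i :=
    finsum_comp_equiv (Equiv.addRight (1 : ℤ))
  have hs {f : ℤ → ℤ} (hf : (Function.support f).Finite) :
      (Function.support fun i ↦ f (i + 1)).Finite :=
    hf.preimage (add_left_injective (1 : ℤ)).injOn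
  have := finsum_congr key
  rw [finsum_add_distrib (hs (hχ _)) (hs hρ), finsum_add_distrib _ hρ,
    finsum_add_distrib (hs (hχ _)) (hs (hχ _)), shift, shift, shift, shift] at this
  · exact add_right_cancel this
  · exact ((hs (hχ t.obj₁)).union (hs (hχ t.obj₃))).subset (Function.support_add _ _)

lemma len_coh_congr {X Y : DerivedCategory.Bounded C} (e : X ≅ Y) (i : ℤ) :
    ℓ.len ((coh i).obj X) = ℓ.len ((coh i).obj Y) :=
  ℓ.len_congr ((coh i).mapIso e)

lemma euler_of_concentrated {X : DerivedCategory.Bounded C} {d : ℤ}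
    (h : ∀ i, i ≠ d → IsZero ((coh i).obj X)) :
    ℓ.euler X = (d.negOnePow : ℤ) * ℓ.len ((coh d).obj X) :=
  finsum_eq_single _ d fun i hi ↦ by simp [ℓ.len_of_isZero (h i hi)]

lemma totalLen_of_concentrated {X : DerivedCategory.Bounded C} {d : ℤ}
    (h : ∀ i, i ≠ d → IsZero ((coh i).obj X)) : ℓ.totalLen X = ℓ.len ((coh d).obj X) :=
  finsum_eq_single _ d fun i hi ↦ ℓ.len_of_isZero (h i hi)

lemma totalLen_pos {X : DerivedCategory.Bounded C} (hX : ¬ IsZero X) : 0 < ℓ.totalLen X := by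
  obtain ⟨i, hi⟩ := nonempty_cohSupport hX
  exact finsum_pos (fun _ ↦ Nat.zero_le _)
    ⟨i, Nat.pos_of_ne_zero fun h ↦ hi (ℓ.isZero_of_len h)⟩ (ℓ.finite_support_len X)

/-- The Euler characteristic on the Grothendieck group. -/
noncomputable def eulerHom : K₀ (DerivedCategory.Bounded C) →+ ℤ :=
  QuotientAddGroup.lift _ (FreeAbelianGroup.lift ℓ.euler) (by
    rw [AddSubgroup.closure_le]
    rintro _ ⟨t, ht, rfl⟩
    simp [ℓ.euler_eq_add ht])

lemma eulerHom_of (X : DerivedCategory.Bounded C) : ℓ.eulerHom (K₀.of X) = ℓ.euler X :=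
  FreeAbelianGroup.lift_apply_of _ _

/-- The simple object, as a complex in degree zero. -/
noncomputable def simpleObj : DerivedCategory.Bounded C := (sgl 0).obj ℓ.simple

lemma isZero_coh_simpleObj {i : ℤ} (hi : i ≠ 0) : IsZero ((coh i).obj ℓ.simpleObj) :=
  isZero_coh_sgl _ _ _ hi

lemma euler_simpleObj : ℓ.euler ℓ.simpleObj = 1 := by
  rw [ℓ.euler_of_concentrated (d := 0) fun i ↦ ℓ.isZero_coh_simpleObj]
  have := ℓ.len_congr ((sglCohIso 0).app ℓ.simple)
  dsimp at this
  rw [simpleObj, this, ℓ.len_simple]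
  simp

lemma not_isZero_simpleObj : ¬ IsZero ℓ.simpleObj := fun h ↦
  ℓ.not_isZero_simple (((sglCohIso 0).app ℓ.simple).isZero_iff.1 ((coh 0).map_isZero h))

end Euler

end LocalLength

section K₀

variable {T : Type u} [Category.{v} T] [Preadditive T] [HasZeroObject T] [HasShift T ℤ]
  [∀ n : ℤ, (shiftFunctor T n).Additive] [Pretriangulated T]

lemma K₀.of_obj₂ {t : Triangle T} (ht : t ∈ distTriang T) :
    K₀.of t.obj₂ = K₀.of t.obj₁ + K₀.of t.obj₃ := by
  refine (QuotientAddGroup.eq_iff_sub_mem (N := AddSubgroup.closure _)).2 ?_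
  exact AddSubgroup.subset_closure ⟨t, ht, rfl⟩

open scoped ZeroObject

lemma K₀.of_zero : K₀.of (0 : T) = 0 := by
  have : K₀.of (0 : T) = K₀.of (0 : T) + K₀.of (0 : T) :=
    K₀.of_obj₂ (contractible_distinguished (0 : T))
  simpa using this

lemma K₀.of_congr {X Y : T} (e : X ≅ Y) : K₀.of X = K₀.of Y := by
  have : K₀.of Y = K₀.of X + K₀.of (0 : T) :=
    K₀.of_obj₂ (isomorphic_distinguished _ (contractible_distinguished X)
      (Triangle.mk e.hom (0 : Y ⟶ 0) (0 : 0 ⟶ X⟦(1 : ℤ)⟧))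
      (Triangle.isoMk _ _ (Iso.refl _) e.symm (Iso.refl _)
        (e.hom_inv_id.trans (Category.id_comp _).symm) (zero_comp.trans comp_zero.symm)
        (zero_comp.trans comp_zero.symm)))
  rw [this, K₀.of_zero, add_zero]

lemma K₀.of_isZero {X : T} (hX : IsZero X) : K₀.of X = 0 := by
  rw [K₀.of_congr hX.isoZero, K₀.of_zero]

lemma K₀.of_shift_one (X : T) : K₀.of (X⟦(1 : ℤ)⟧) = - K₀.of X := by
  have : K₀.of (0 : T) = K₀.of X + K₀.of (X⟦(1 : ℤ)⟧) :=
    K₀.of_obj₂ (rot_of_distTriang _ (contractible_distinguished X))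
  rw [K₀.of_zero] at this
  exact (neg_eq_of_add_eq_zero_right this.symm).symm

lemma K₀.addMonoidHom_ext {A : Type*} [AddCommGroup A] {f g : K₀ T →+ A}
    (h : ∀ X : T, f (K₀.of X) = g (K₀.of X)) : f = g := by
  refine QuotientAddGroup.addMonoidHom_ext _ (FreeAbelianGroup.lift_ext _ _ h)

end K₀

/-! ### The standard slicings -/

section Slicing

variable {C : Type u} [Category.{v} C] [Abelian C] [HasDerivedCategory.{w} C]

/-- The slicing with `P φ = C⟦φ - ψ⟧` for `φ ∈ ψ + ℤ`, and `P φ = 0` otherwise: the cohomology of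
an object of phase `φ` lives in degree `ψ - φ` only. -/
def stdSlice (ψ φ : ℝ) : ObjectProperty (DerivedCategory.Bounded C) :=
  fun E ↦ ∀ i : ℤ, ¬ IsZero ((coh i).obj E) → φ + i = ψ

lemma stdSlice_of_isZero (ψ φ : ℝ) {E : DerivedCategory.Bounded C} (hE : IsZero E) :
    stdSlice ψ φ E := fun i hi ↦ (hi ((coh i).map_isZero hE)).elim

lemma stdSlice_of_iso {ψ φ : ℝ} {E F : DerivedCategory.Bounded C} (e : E ≅ F)
    (h : stdSlice ψ φ E) : stdSlice ψ φ F :=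
  fun i hi ↦ h i (mt ((coh i).mapIso e).isZero_iff.1 hi)

lemma stdSlice_of_concentrated {ψ φ : ℝ} {d : ℤ} (hd : φ + d = ψ) {E : DerivedCategory.Bounded C}
    (h : ∀ i, i ≠ d → IsZero ((coh i).obj E)) : stdSlice ψ φ E := fun i hi ↦ by
  rw [show i = d from by_contra fun h' ↦ hi (h i h'), hd]

lemma stdSlice.isZero_coh {ψ φ : ℝ} {E : DerivedCategory.Bounded C} (h : stdSlice ψ φ E) {d : ℤ}
    (hd : φ + d = ψ) {i : ℤ} (hi : i ≠ d) : IsZero ((coh i).obj E) := by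
  by_contra h'
  exact hi (by exact_mod_cast add_left_cancel ((h i h').trans hd.symm))

lemma stdSlice.exists_degree {ψ φ : ℝ} {E : DerivedCategory.Bounded C} (h : stdSlice ψ φ E)
    (hE : ¬ IsZero E) :
    ∃ d : ℤ, φ + d = ψ ∧ ¬ IsZero ((coh d).obj E) ∧ ∀ i, i ≠ d → IsZero ((coh i).obj E) := by
  obtain ⟨d, hd⟩ := nonempty_cohSupport hE
  exact ⟨d, h d hd, hd, fun i hi ↦ h.isZero_coh (h d hd) hi⟩

lemma stdSlice_obj₂ {ψ φ : ℝ} {t : Triangle (DerivedCategory.Bounded C)} (ht : t ∈ distTriang _)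
    (h₁ : stdSlice ψ φ t.obj₁) (h₃ : stdSlice ψ φ t.obj₃) : stdSlice ψ φ t.obj₂ := by
  intro i hi
  by_cases h : IsZero ((coh i).obj t.obj₁)
  · exact h₃ i fun h' ↦ hi (isZero_coh₂ ht i h h')
  · exact h₁ i h

instance (ψ φ : ℝ) : (stdSlice (C := C) ψ φ).IsClosedUnderIsomorphisms where
  of_iso := stdSlice_of_iso

lemma stdSlice_closedUnderSums (ψ φ : ℝ) :
    (stdSlice (C := C) ψ φ).IsClosedUnderBinaryProducts :=
  ObjectProperty.IsClosedUnderLimitsOfShape.mk' (by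
    rintro _ ⟨K, hK⟩
    exact stdSlice_of_iso (HasLimit.isoOfNatIso (diagramIsoPair K)).symm
      (stdSlice_obj₂ (binaryProductTriangle_distinguished _ _) (hK _) (hK _)))

lemma stdSlice_shift_iff (ψ φ : ℝ) (E : DerivedCategory.Bounded C) :
    stdSlice ψ (φ + 1) (E⟦(1 : ℤ)⟧) ↔ stdSlice ψ φ E := by
  constructor
  · intro h i hi
    have := h (i - 1) (mt (cohShiftIso E 1 (i - 1) i (by lia)).isZero_iff.1 hi)
    push_cast at this
    linarith
  · intro h i hi
    have := h (1 + i) (mt (cohShiftIso E 1 i (1 + i) rfl).isZero_iff.2 hi)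
    push_cast at this
    linarith

lemma stdSlice_hom_eq_zero {ψ φ₁ φ₂ : ℝ} (h : φ₂ < φ₁) {E₁ E₂ : DerivedCategory.Bounded C}
    (h₁ : stdSlice ψ φ₁ E₁) (h₂ : stdSlice ψ φ₂ E₂) (f : E₁ ⟶ E₂) : f = 0 := by
  by_cases z₁ : IsZero E₁
  · exact z₁.eq_of_src _ _
  by_cases z₂ : IsZero E₂
  · exact z₂.eq_of_tgt _ _
  obtain ⟨d₁, e₁, -, c₁⟩ := h₁.exists_degree z₁
  obtain ⟨d₂, e₂, -, c₂⟩ := h₂.exists_degree z₂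
  have hd : d₁ < d₂ := by
    have : (d₁ : ℝ) < d₂ := by linarith
    exact_mod_cast this
  have := (tBounded_isLE_iff E₁ d₁).2 fun i hi ↦ c₁ i hi.ne'
  have := (tBounded_isGE_iff E₂ d₂).2 fun i hi ↦ c₂ i hi.ne
  exact (tBounded C).zero f d₁ d₂ hd

lemma isZero_coh_truncLT_iff (E : DerivedCategory.Bounded C) (a i : ℤ) :
    IsZero ((coh i).obj (((tBounded C).truncLT a).obj E)) ↔ a ≤ i ∨ IsZero ((coh i).obj E) := by
  have ht := (tBounded C).triangleLTGE_distinguished a E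
  have h₁ := (tBounded_isLE_iff (((tBounded C).truncLT a).obj E) (a - 1)).1 inferInstance
  have h₃ := (tBounded_isGE_iff (((tBounded C).truncGE a).obj E) a).1 inferInstance
  rcases le_or_gt a i with h | h
  · exact iff_of_true (h₁ i (by lia)) (Or.inl h)
  · refine ⟨fun h' ↦ Or.inr (isZero_coh₂ ht i h' (h₃ i h)), ?_⟩
    rintro (h' | h')
    · exact (h'.not_gt h).elim
    · exact isZero_coh₁ ht (i - 1) i (by lia) (h₃ _ (by lia)) h'

lemma isZero_coh_truncGE_iff (E : DerivedCategory.Bounded C) (a i : ℤ) :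
    IsZero ((coh i).obj (((tBounded C).truncGE a).obj E)) ↔ i < a ∨ IsZero ((coh i).obj E) := by
  have ht := (tBounded C).triangleLTGE_distinguished a E
  have h₁ := (tBounded_isLE_iff (((tBounded C).truncLT a).obj E) (a - 1)).1 inferInstance
  have h₃ := (tBounded_isGE_iff (((tBounded C).truncGE a).obj E) a).1 inferInstance
  rcases lt_or_ge i a with h | h
  · exact iff_of_true (h₃ i h) (Or.inl h)
  · refine ⟨fun h' ↦ Or.inr (isZero_coh₂ ht i (h₁ i (by lia)) h'), ?_⟩
    rintro (h' | h')
    · exact (h'.not_ge h).elim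
    · exact isZero_coh₃ ht i (i + 1) rfl h' (h₁ _ (by lia))

lemma isZero_coh_truncGELT_iff (E : DerivedCategory.Bounded C) (a b i : ℤ) :
    IsZero ((coh i).obj (((tBounded C).truncGELT a b).obj E)) ↔
      (i < a ∨ b ≤ i) ∨ IsZero ((coh i).obj E) := by
  refine (isZero_coh_truncGE_iff _ a i).trans ?_
  rw [isZero_coh_truncLT_iff, or_assoc]

/-- The Harder-Narasimhan filtrations of the standard slicings are given by the truncations at the
degrees `d₀ < ⋯ < dₙ` of nonvanishing cohomology: the cuts are `d₀, …, dₙ, dₙ + 1`. -/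
lemma nonempty_hnFiltration_stdSlice (ψ : ℝ) {E : DerivedCategory.Bounded C} (hE : ¬ IsZero E) :
    Nonempty (HNFiltration (stdSlice ψ) E) := by
  let s : Finset ℤ := (finite_cohSupport E).toFinset
  have mem_s (i : ℤ) : i ∈ s ↔ ¬ IsZero ((coh i).obj E) := (finite_cohSupport E).mem_toFinset
  obtain ⟨n, hn⟩ : ∃ n, s.card = n + 1 := by
    refine Nat.exists_eq_succ_of_ne_zero (Finset.card_ne_zero.2 ?_)
    obtain ⟨i, hi⟩ := nonempty_cohSupport hE
    exact ⟨i, (mem_s i).2 hi⟩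
  let d : Fin (n + 1) ↪o ℤ := s.orderEmbOfFin hn
  have hd (j) : d j ∈ s := s.orderEmbOfFin_mem hn j
  have exists_d {i : ℤ} (hi : i ∈ s) : ∃ j, d j = i := by
    have := (s.range_orderEmbOfFin hn).symm ▸ (Finset.mem_coe.2 hi)
    exact this
  let c : Fin (n + 2) → ℤ := Fin.snoc d (d (Fin.last n) + 1)
  have c_castSucc (j : Fin (n + 1)) : c j.castSucc = d j := Fin.snoc_castSucc (α := fun _ ↦ ℤ) ..
  have c_last : c (Fin.last (n + 1)) = d (Fin.last n) + 1 := Fin.snoc_last (α := fun _ ↦ ℤ) ..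
  have d_lt (j : Fin (n + 1)) : d j < c j.succ := by
    induction j using Fin.lastCases with
    | last => rw [Fin.succ_last, c_last]; exact lt_add_one _
    | cast j =>
      rw [Fin.succ_castSucc, c_castSucc]
      exact d.strictMono j.castSucc_lt_succ
  have eq_d (j : Fin (n + 1)) {i : ℤ} (hi : i ∈ s) (h₁ : d j ≤ i) (h₂ : i < c j.succ) :
      i = d j := by
    obtain ⟨m, rfl⟩ := exists_d hi
    have h₁ : j ≤ m := d.le_iff_le.1 h₁
    refine congrArg d (le_antisymm ?_ h₁)
    induction j using Fin.lastCases with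
    | last => exact Fin.le_last m
    | cast j =>
      rw [Fin.succ_castSucc, c_castSucc, d.lt_iff_lt] at h₂
      exact Fin.le_castSucc_iff.2 h₂
  have le_last {i : ℤ} (hi : i ∈ s) : i ≤ d (Fin.last n) := by
    obtain ⟨m, rfl⟩ := exists_d hi
    exact d.monotone (Fin.le_last m)
  have hle (j : Fin (n + 1)) : c j.castSucc ≤ c j.succ := (c_castSucc j).trans_le (d_lt j).le
  have hfac (j : Fin (n + 1)) (i : ℤ) :
      IsZero ((coh i).obj (((tBounded C).truncGELT (c j.castSucc) (c j.succ)).obj E)) ↔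
        i ≠ d j := by
    rw [isZero_coh_truncGELT_iff, c_castSucc]
    constructor
    · rintro h rfl
      have := d_lt j
      rcases h with (h | h) | h
      · lia
      · lia
      · exact (mem_s _).1 (hd j) h
    · intro h
      by_contra! h'
      exact h (eq_d j ((mem_s i).2 h'.2) h'.1.1 h'.1.2)
  have hE_le : (tBounded C).IsLE E (d (Fin.last n)) := (tBounded_isLE_iff _ _).2 fun i hi ↦ by
    by_contra h
    exact hi.not_ge (le_last ((mem_s i).2 h))
  have := ((tBounded C).isLE_iff_isIso_truncLTι_app (d (Fin.last n)) _ c_last.symm E).1 hE_le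
  exact ⟨{
    n := n
    obj := fun j ↦ ((tBounded C).truncLT (c j)).obj E
    factor := fun j ↦ ((tBounded C).truncGELT (c j.castSucc) (c j.succ)).obj E
    phase := fun j ↦ ψ - d j
    incl := fun j ↦ _
    proj := fun j ↦ _
    conn := fun j ↦ _
    distinguished := fun j ↦ (tBounded C).triangleLTLTGELT_distinguished _ _ (hle j) E
    isZero_bot := (isZero_iff_coh _).2 fun i ↦ by
      rw [isZero_coh_truncLT_iff, ← Fin.castSucc_zero, c_castSucc]
      by_contra! h
      obtain ⟨m, rfl⟩ := exists_d ((mem_s i).2 h.2)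
      exact h.1.not_ge (d.monotone (Fin.zero_le m))
    top := asIso (((tBounded C).truncLTι _).app E)
    semistable := fun j ↦ stdSlice_of_concentrated (sub_add_cancel _ _) fun i ↦ (hfac j i).2
    factor_ne_zero := fun j h ↦ (hfac j (d j)).1 ((coh _).map_isZero h) rfl
    strictAnti := fun i j h ↦ by
      have : (d i : ℝ) < d j := by exact_mod_cast d.strictMono h
      linarith }⟩

end Slicing

section HN

lemma HNFiltration.K₀_of_eq_sum {T : Type u} [Category.{v} T] [Preadditive T] [HasZeroObject T]
    [HasShift T ℤ] [∀ n : ℤ, (shiftFunctor T n).Additive] [Pretriangulated T]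
    {P : ℝ → ObjectProperty T} {E : T} (F : HNFiltration P E) :
    K₀.of E = ∑ j, K₀.of (F.factor j) := by
  have key (m : Fin (F.n + 2)) :
      K₀.of (F.obj m) = ∑ j, if j.castSucc < m then K₀.of (F.factor j) else 0 := by
    induction m using Fin.induction with
    | zero => simp [K₀.of_isZero F.isZero_bot]
    | succ m ih =>
      have : K₀.of (F.obj m.succ) = K₀.of (F.obj m.castSucc) + K₀.of (F.factor m) :=
        K₀.of_obj₂ (F.distinguished m)
      rw [this, ih, ← Fintype.sum_ite_eq m fun j ↦ K₀.of (F.factor j), ← Finset.sum_add_distrib]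
      refine Finset.sum_congr rfl fun j _ ↦ ?_
      rcases lt_trichotomy j m with h | h | h
      · simp [h, h.ne', h.le, Fin.castSucc_lt_succ_iff]
      · simp [h]
      · simp [h.not_gt, h.ne, h.not_ge, Fin.castSucc_lt_succ_iff]
  rw [← K₀.of_congr F.top, key]
  simp [Fin.castSucc_lt_last]

variable {C : Type u} [Category.{v} C] [Abelian C] [HasDerivedCategory.{w} C] (ℓ : LocalLength C)

namespace LocalLength

lemma len_coh_eq_add {t : Triangle (DerivedCategory.Bounded C)} (ht : t ∈ distTriang _)
    (h : ∀ i, IsZero ((coh i).obj t.obj₃) ∨ IsZero ((coh (i + 1)).obj t.obj₁)) (i : ℤ) :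
    ℓ.len ((coh i).obj t.obj₂) = ℓ.len ((coh i).obj t.obj₁) + ℓ.len ((coh i).obj t.obj₃) := by
  have : Mono ((coh i).map t.mor₁) := by
    rcases h (i - 1) with h | h
    · exact mono_coh_mor₁ ht (i - 1) i (by lia) h
    · rw [sub_add_cancel] at h
      exact ⟨fun _ _ _ ↦ h.eq_of_tgt _ _⟩
  have : Epi ((coh i).map t.mor₂) := by
    rcases h i with h | h
    · exact ⟨fun _ _ _ ↦ h.eq_of_src _ _⟩
    · exact epi_coh_mor₂ ht i (i + 1) rfl h
  exact ℓ.len_eq_add { exact := coh_exact₂ ht i, mono_f := ‹_›, epi_g := ‹_› }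

end LocalLength

variable {P : ℝ → ObjectProperty (DerivedCategory.Bounded C)} {ψ : ℝ}
  (hP : ∀ φ X, P φ X → stdSlice ψ φ X) {E : DerivedCategory.Bounded C} (F : HNFiltration P E)
include hP

lemma HNFiltration.exists_degrees :
    ∃ d : Fin (F.n + 1) → ℤ, StrictMono d ∧ (∀ j, F.phase j + d j = ψ) ∧
      ∀ j i, IsZero ((coh i).obj (F.factor j)) ↔ i ≠ d j := by
  choose d h₁ h₂ h₃ using fun j ↦ (hP _ _ (F.semistable j)).exists_degree (F.factor_ne_zero j)
  refine ⟨d, fun i j h ↦ ?_, h₁, fun j i ↦ ⟨?_, h₃ j i⟩⟩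
  · have h₄ := h₁ i
    have h₅ := h₁ j
    have h₆ := F.strictAnti h
    have : (d i : ℝ) < d j := by linarith
    exact_mod_cast this
  · rintro h rfl
    exact h₂ j h

/-- The factors of the filtration live in increasing degrees, so that the long exact sequences
split into short ones. -/
lemma HNFiltration.len_coh_eq_sum (i : ℤ) :
    ℓ.len ((coh i).obj E) = ∑ j, ℓ.len ((coh i).obj (F.factor j)) := by
  obtain ⟨d, hd, -, hz⟩ := F.exists_degrees hP
  have key (m : Fin (F.n + 2)) : ∀ i, ℓ.len ((coh i).obj (F.obj m)) =
      ∑ j, if j.castSucc < m then ℓ.len ((coh i).obj (F.factor j)) else 0 := by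
    induction m using Fin.induction with
    | zero => intro i; simp [ℓ.len_of_isZero ((coh i).map_isZero F.isZero_bot)]
    | succ m ih =>
      intro i
      have : ℓ.len ((coh i).obj (F.obj m.succ)) =
          ℓ.len ((coh i).obj (F.obj m.castSucc)) + ℓ.len ((coh i).obj (F.factor m)) := by
        refine ℓ.len_coh_eq_add (F.distinguished m) (fun i ↦ ?_) i
        refine or_iff_not_imp_left.2 fun h ↦ ?_
        have h : i = d m := by_contra fun h' ↦ h ((hz m i).2 h')
        refine ℓ.isZero_of_len ((ih (i + 1)).trans (Finset.sum_eq_zero fun j _ ↦ ?_))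
        refine ite_eq_right_iff.2 fun hj ↦ ℓ.len_of_isZero ((hz j _).2 ?_)
        have := hd (Fin.castSucc_lt_castSucc_iff.1 hj)
        lia
      rw [this, ih, ← Fintype.sum_ite_eq m fun j ↦ ℓ.len ((coh i).obj (F.factor j)),
        ← Finset.sum_add_distrib]
      refine Finset.sum_congr rfl fun j _ ↦ ?_
      rcases lt_trichotomy j m with h | h | h
      · simp [h, h.ne', h.le, Fin.castSucc_lt_succ_iff]
      · simp [h]
      · simp [h.not_gt, h.ne, h.not_ge, Fin.castSucc_lt_succ_iff]
  rw [← ℓ.len_coh_congr F.top, key]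
  simp [Fin.castSucc_lt_last]

lemma HNFiltration.totalLen_eq_sum : ℓ.totalLen E = ∑ j, ℓ.totalLen (F.factor j) := by
  unfold LocalLength.totalLen
  rw [finsum_congr (F.len_coh_eq_sum ℓ hP), finsum_sum_comm]
  exact fun j _ ↦ ℓ.finite_support_len (F.factor j)

include ℓ in
lemma HNFiltration.exists_degrees_range :
    ∃ d : Fin (F.n + 1) → ℤ, StrictMono d ∧ (∀ j, F.phase j + d j = ψ) ∧
      cohSupport E = Set.range d := by
  obtain ⟨d, hd, hφ, hz⟩ := F.exists_degrees hP
  refine ⟨d, hd, hφ, Set.ext fun i ↦ ?_⟩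
  change ¬ IsZero _ ↔ _
  rw [← ℓ.len_eq_zero_iff, F.len_coh_eq_sum ℓ hP, Finset.sum_eq_zero_iff]
  simp [ℓ.len_eq_zero_iff, hz, eq_comm]

include ℓ in
lemma HNFiltration.exists_isLeast :
    ∃ d : ℤ, IsLeast (cohSupport E) d ∧ F.phase 0 + d = ψ := by
  obtain ⟨d, hd, hφ, hs⟩ := F.exists_degrees_range ℓ hP
  refine ⟨d 0, ?_, hφ 0⟩
  rw [hs]
  exact ⟨⟨0, rfl⟩, by rintro _ ⟨j, rfl⟩; exact hd.monotone (Fin.zero_le j)⟩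

include ℓ in
lemma HNFiltration.exists_isGreatest :
    ∃ d : ℤ, IsGreatest (cohSupport E) d ∧ F.phase (Fin.last _) + d = ψ := by
  obtain ⟨d, hd, hφ, hs⟩ := F.exists_degrees_range ℓ hP
  refine ⟨d (Fin.last _), ?_, hφ _⟩
  rw [hs]
  exact ⟨⟨_, rfl⟩, by rintro _ ⟨j, rfl⟩; exact hd.monotone (Fin.le_last j)⟩

include ℓ F in
/-- A slicing contained in a standard one is equal to it, since the Harder-Narasimhan filtration
of an object with cohomology in a single degree has a single step. -/
lemma HNFiltration.semistable_of_stdSlice (hiso : ∀ φ, (P φ).IsClosedUnderIsomorphisms) {φ : ℝ}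
    (hE : stdSlice ψ φ E) : P φ E := by
  obtain ⟨d, hd, hφ, hs⟩ := F.exists_degrees_range ℓ hP
  have hmem (j) : ¬ IsZero ((coh (d j)).obj E) := by
    have : d j ∈ cohSupport E := hs ▸ ⟨j, rfl⟩
    exact this
  have hphase (j) : F.phase j = φ := by
    have := hE _ (hmem j)
    have := hφ j
    linarith
  have hn : F.n = 0 := by
    have := F.strictAnti.injective ((hphase 0).trans (hphase (Fin.last _)).symm)
    simpa using (congrArg Fin.val this).symm
  have : IsIso (F.proj 0) :=
    (Triangle.isZero₁_iff_isIso₂ _ (F.distinguished 0)).1 F.isZero_bot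
  have hlast : (0 : Fin (F.n + 1)).succ = Fin.last (F.n + 1) := Fin.ext (by simp [hn])
  exact (P φ).prop_of_iso
    ((asIso (F.proj 0)).symm ≪≫ eqToIso (congrArg F.obj hlast) ≪≫ F.top)
    (hphase 0 ▸ F.semistable 0)

end HN

/-! ### Classification of the stability conditions -/

section Shift

variable {T : Type u} [Category.{v} T] [Preadditive T] [HasZeroObject T] [HasShift T ℤ]
  [∀ n : ℤ, (shiftFunctor T n).Additive] [Pretriangulated T]

lemma StabilityCondition.semistable_shift (σ : StabilityCondition T) {φ : ℝ} {E : T}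
    (hE : σ.P φ E) (n : ℤ) : σ.P (φ + n) (E⟦n⟧) := by
  have := σ.closedUnderIso
  induction n using Int.induction_on with
  | zero =>
    rw [Int.cast_zero, add_zero]
    exact (σ.P φ).prop_of_iso ((shiftFunctorZero T ℤ).app E).symm hE
  | succ n ih =>
    push_cast at ih ⊢
    rw [← add_assoc]
    exact (σ.P _).prop_of_iso ((shiftFunctorAdd T (n : ℤ) 1).app E).symm ((σ.shift_iff _ _).2 ih)
  | pred n ih =>
    refine (σ.shift_iff _ _).1 ?_
    push_cast at ih ⊢
    rw [show φ + (-(n : ℝ) - 1) + 1 = φ + -(n : ℝ) by ring]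
    exact (σ.P _).prop_of_iso ((shiftFunctorAdd' T (-(n : ℤ) - 1) 1 (-n) (by ring)).app E) ih

lemma K₀.of_shift (X : T) (n : ℤ) : K₀.of (X⟦n⟧) = (n.negOnePow : ℤ) • K₀.of X := by
  induction n using Int.induction_on with
  | zero => simp [K₀.of_congr ((shiftFunctorZero T ℤ).app X)]
  | succ n ih =>
    rw [K₀.of_congr ((shiftFunctorAdd T (n : ℤ) 1).app X)]
    refine (K₀.of_shift_one _).trans ?_
    rw [ih, Int.negOnePow_succ, Units.val_neg, neg_smul]
  | pred n ih =>
    have h : K₀.of (X⟦-(n : ℤ)⟧) = - K₀.of (X⟦-(n : ℤ) - 1⟧) := by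
      rw [K₀.of_congr ((shiftFunctorAdd' T (-(n : ℤ) - 1) 1 (-n) (by ring)).app X)]
      exact K₀.of_shift_one _
    rw [← neg_eq_iff_eq_neg, ih] at h
    rw [← h, ← neg_smul, ← Units.val_neg, ← Int.negOnePow_succ,
      show -(n : ℤ) = -(n : ℤ) - 1 + 1 by ring, Int.negOnePow_succ, Int.negOnePow_succ]
    simp

end Shift

namespace LocalLength

variable {C : Type u} [Category.{v} C] [Abelian C] [HasDerivedCategory.{w} C] (ℓ : LocalLength C)
include ℓ

/-- If the highest cohomology of `E` and the lowest cohomology of `F` are in the same degree, then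
there is a nonzero map from `E` to `F`: the former has the simple object as a quotient, and the
latter has it as a subobject. -/
lemma exists_hom_ne_zero {E F : DerivedCategory.Bounded C} {q : ℤ}
    (hE : IsGreatest (cohSupport E) q) (hF : IsLeast (cohSupport F) q) :
    ∃ g : E ⟶ F, g ≠ 0 := by
  have vE (i) (hi : q < i) : IsZero ((coh i).obj E) := by
    by_contra h
    exact hi.not_ge (hE.2 h)
  have vF (i) (hi : i < q) : IsZero ((coh i).obj F) := by
    by_contra h
    exact hi.not_ge (hF.2 h)
  have htE := (tBounded C).triangleLTGE_distinguished q E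
  have htF := (tBounded C).triangleLTGE_distinguished (q + 1) F
  let Y := ((tBounded C).truncGE q).obj E
  let X := ((tBounded C).truncLT (q + 1)).obj F
  let π : E ⟶ Y := ((tBounded C).truncGEπ q).app E
  let ι : X ⟶ F := ((tBounded C).truncLTι (q + 1)).app F
  have hπ : Epi ((coh q).map π) :=
    epi_coh_mor₂ htE q (q + 1) rfl ((isZero_coh_truncLT_iff _ _ _).2 (Or.inl (by lia)))
  have hι : Mono ((coh q).map ι) :=
    mono_coh_mor₁ htF (q - 1) q (by lia) ((isZero_coh_truncGE_iff _ _ _).2 (Or.inl (by lia)))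
  obtain ⟨M, ⟨eM⟩⟩ : ∃ M : C, Nonempty (Y ≅ (sgl q).obj M) := exists_iso_sgl fun i hi ↦ by
    refine (isZero_coh_truncGE_iff _ _ _).2 (hi.lt_or_gt.imp_right (vE i))
  obtain ⟨N, ⟨eN⟩⟩ : ∃ N : C, Nonempty (X ≅ (sgl q).obj N) := exists_iso_sgl fun i hi ↦ by
    refine (isZero_coh_truncLT_iff _ _ _).2 (hi.lt_or_gt.symm.imp (fun h ↦ ?_) (vF i))
    lia
  have hM : ¬ IsZero M := fun h ↦ by
    have := (coh q).map_isZero (((sgl q).map_isZero h).of_iso eM)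
    rcases (isZero_coh_truncGE_iff _ _ _).1 this with h | h
    · exact lt_irrefl _ h
    · exact hE.1 h
  have hN : ¬ IsZero N := fun h ↦ by
    have := (coh q).map_isZero (((sgl q).map_isZero h).of_iso eN)
    rcases (isZero_coh_truncLT_iff _ _ _).1 this with h | h
    · lia
    · exact hF.1 h
  obtain ⟨p, hp⟩ := ℓ.exists_epi hM
  obtain ⟨m, hm⟩ := ℓ.exists_mono hN
  refine ⟨π ≫ (eM.hom ≫ (sgl q).map (p ≫ m) ≫ eN.inv) ≫ ι, fun h ↦ ?_⟩
  have h := congrArg (coh q).map h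
  rw [Functor.map_zero, Functor.map_comp, Functor.map_comp, ← comp_zero (f := (coh q).map π),
    cancel_epi, ← zero_comp (f := (coh q).map ι), cancel_mono, Functor.map_comp, Functor.map_comp,
    ← comp_zero (f := (coh q).map eM.hom), cancel_epi, ← zero_comp (f := (coh q).map eN.inv),
    cancel_mono] at h
  have h' := (sglCohIso q).hom.naturality (p ≫ m)
  dsimp at h'
  rw [h, zero_comp, ← comp_zero (f := (sglCohIso q).hom.app M), cancel_epi,
    ← comp_zero (f := p), cancel_epi] at h'
  refine ℓ.not_isZero_simple ((IsZero.iff_id_eq_zero _).2 ?_)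
  rw [← cancel_mono m, ← h', comp_zero, comp_zero]

lemma phase_le {σ : StabilityCondition (DerivedCategory.Bounded C)} {φ φ' : ℝ}
    {E F : DerivedCategory.Bounded C} (hE : σ.P φ E) (hF : σ.P φ' F) {q r : ℤ}
    (hq : IsGreatest (cohSupport E) q) (hr : IsLeast (cohSupport F) r) :
    φ + q ≤ φ' + r := by
  have hr' : IsLeast (cohSupport (F⟦r - q⟧)) q := by
    constructor
    · exact mt (cohShiftIso F (r - q) q r (by ring)).isZero_iff.1 hr.1
    · intro i hi
      have := hr.2 (mt (cohShiftIso F (r - q) i (r - q + i) rfl).isZero_iff.2 hi)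
      lia
  obtain ⟨g, hg⟩ := ℓ.exists_hom_ne_zero hq hr'
  by_contra! h
  refine hg (σ.hom_eq_zero φ (φ' + (r - q : ℤ)) ?_ _ _ hE (σ.semistable_shift hF _) g)
  push_cast
  linarith

/-- Every slicing is a standard one: `LocalLength.phase_le` shows that a semistable object has
cohomology in a single degree, and that the sum of this degree and of the phase is constant. -/
theorem exists_eq_stdSlice (σ : StabilityCondition (DerivedCategory.Bounded C)) :
    ∃ ψ, ∀ φ E, σ.P φ E ↔ stdSlice ψ φ E := by
  have hmax {E : DerivedCategory.Bounded C} (hE : ¬ IsZero E) :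
      ∃ q, IsGreatest (cohSupport E) q := by
    obtain ⟨q, h₁, h₂⟩ :=
      Set.exists_max_image _ id (finite_cohSupport E) (nonempty_cohSupport hE)
    exact ⟨q, h₁, fun i hi ↦ h₂ i hi⟩
  have hmin {E : DerivedCategory.Bounded C} (hE : ¬ IsZero E) :
      ∃ q, IsLeast (cohSupport E) q := by
    obtain ⟨q, h₁, h₂⟩ :=
      Set.exists_min_image _ id (finite_cohSupport E) (nonempty_cohSupport hE)
    exact ⟨q, h₁, fun i hi ↦ h₂ i hi⟩
  obtain ⟨F₀⟩ := σ.exists_hn ℓ.simpleObj ℓ.not_isZero_simpleObj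
  obtain ⟨q₀, hq₀⟩ := hmax (F₀.factor_ne_zero 0)
  obtain ⟨r₀, hr₀⟩ := hmin (F₀.factor_ne_zero 0)
  have h₀ := ℓ.phase_le (F₀.semistable 0) (F₀.semistable 0) hq₀ hr₀
  have hP : ∀ φ E, σ.P φ E → stdSlice (F₀.phase 0 + q₀) φ E := by
    intro φ E hE i hi
    have hE₀ : ¬ IsZero E := fun h ↦ hi ((coh i).map_isZero h)
    obtain ⟨q, hq⟩ := hmax hE₀
    obtain ⟨r, hr⟩ := hmin hE₀
    have h₁ := ℓ.phase_le hE (F₀.semistable 0) hq hr₀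
    have h₂ := ℓ.phase_le (F₀.semistable 0) hE hq₀ hr
    have h₃ : (r : ℝ) ≤ i := by exact_mod_cast hr.2 hi
    have h₄ : (i : ℝ) ≤ q := by exact_mod_cast hq.2 hi
    have h₅ : (r₀ : ℝ) ≤ q₀ := by exact_mod_cast hr₀.2 hq₀.1
    linarith
  refine ⟨_, fun φ E ↦ ⟨hP φ E, fun hE ↦ ?_⟩⟩
  by_cases hE₀ : IsZero E
  · have := σ.closedUnderIso φ
    have := σ.containsZero φ
    exact (σ.P φ).prop_of_isZero hE₀
  · obtain ⟨F⟩ := σ.exists_hn E hE₀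
    exact F.semistable_of_stdSlice ℓ hP σ.closedUnderIso hE

lemma map_K₀_eq_zero {A : Type*} [AddCommGroup A]
    {g : K₀ (DerivedCategory.Bounded C) →+ A} (hg : g (K₀.of ℓ.simpleObj) = 0)
    (E : DerivedCategory.Bounded C) : g (K₀.of E) = 0 := by
  have h₁ (n : ℕ) : ∀ M : C, ℓ.len M = n → g (K₀.of ((sgl 0).obj M)) = 0 := by
    induction n with
    | zero =>
      intro M hM
      rw [K₀.of_isZero ((sgl 0).map_isZero (ℓ.isZero_of_len hM)), map_zero]
    | succ n ih =>
      intro M hM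
      have hM₀ : ¬ IsZero M := fun h ↦ by
        have := ℓ.len_of_isZero h
        lia
      obtain ⟨m, hm⟩ := ℓ.exists_mono hM₀
      have hl := ℓ.len_add_len_cokernel m
      rw [hM, ℓ.len_simple] at hl
      obtain ⟨δ, hδ⟩ := exists_sgl_triangle (S := ShortComplex.mk m _ (cokernel.condition m))
        { exact := ShortComplex.exact_cokernel m
          mono_f := inferInstance
          epi_g := inferInstance }
      have : K₀.of ((sgl 0).obj M) =
        K₀.of ℓ.simpleObj + K₀.of ((sgl 0).obj (cokernel m)) := K₀.of_obj₂ hδ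
      rw [this, map_add, hg, ih _ (by lia), add_zero]
  have h₂ (E : DerivedCategory.Bounded C) (d : ℤ) (h : ∀ i, i ≠ d → IsZero ((coh i).obj E)) :
      g (K₀.of E) = 0 := by
    obtain ⟨M, ⟨e⟩⟩ : ∃ M : C, Nonempty (E⟦d⟧ ≅ (sgl 0).obj M) := exists_iso_sgl fun i hi ↦
      (h (d + i) (by lia)).of_iso (cohShiftIso E d i _ rfl)
    have h' := h₁ _ M rfl
    rw [← K₀.of_congr e, K₀.of_shift, map_zsmul, ← Units.smul_def] at h'
    exact (smul_eq_zero_iff_eq _).1 h'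
  by_cases hE : IsZero E
  · rw [K₀.of_isZero hE, map_zero]
  · obtain ⟨F⟩ := nonempty_hnFiltration_stdSlice 0 hE
    rw [F.K₀_of_eq_sum, map_sum]
    refine Finset.sum_eq_zero fun j _ ↦ ?_
    obtain ⟨d, -, -, hd⟩ := (F.semistable j).exists_degree (F.factor_ne_zero j)
    exact h₂ _ d hd

/-- The Grothendieck group is generated by the class of the simple object. -/
lemma K₀_of_eq (E : DerivedCategory.Bounded C) :
    K₀.of E = ℓ.euler E • K₀.of ℓ.simpleObj := by
  have := ℓ.map_K₀_eq_zero (g := AddMonoidHom.id _ -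
    ((zmultiplesHom _) (K₀.of ℓ.simpleObj)).comp ℓ.eulerHom)
    (by simp [eulerHom_of, euler_simpleObj]) E
  simpa [eulerHom_of, sub_eq_zero] using this

end LocalLength

/-! ### The standard stability conditions -/

section LocallyFinite

variable {C : Type u} [Category.{v} C] [Abelian C] [HasDerivedCategory.{w} C]

lemma isIso_of_isIso_coh {X Y : DerivedCategory.Bounded C} (f : X ⟶ Y)
    (h : ∀ i, IsIso ((coh i).map f)) : IsIso f :=
  (ObjectProperty.isIso_hom_iff f).1 ((DerivedCategory.isIso_iff C f.hom).2 h)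

lemma mem_Ioo_of_extensionClosure {ψ a b : ℝ} {E : DerivedCategory.Bounded C}
    (hE : ExtensionClosure (fun E ↦ ∃ φ, a < φ ∧ φ < b ∧ stdSlice ψ φ E) E) {i : ℤ}
    (hi : ¬ IsZero ((coh i).obj E)) : a < ψ - i ∧ ψ - i < b := by
  induction hE with
  | of E h =>
    obtain ⟨φ, h₁, h₂, h₃⟩ := h
    rw [← h₃ i hi, add_sub_cancel_right]
    exact ⟨h₁, h₂⟩
  | zero E h => exact (hi ((coh i).map_isZero h)).elim
  | ext t ht _ _ ih₁ ih₃ =>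
    by_cases h : IsZero ((coh i).obj t.obj₁)
    · exact ih₃ fun h' ↦ hi (isZero_coh₂ ht i h h')
    · exact ih₁ h
  | iso E F e _ ih => exact ih (mt ((coh i).mapIso e).isZero_iff.1 hi)

namespace LocalLength

variable (ℓ : LocalLength C) {I : ObjectProperty (DerivedCategory.Bounded C)} {d : ℤ}
  (hI : ∀ E, I E → ∀ i, i ≠ d → IsZero ((coh i).obj E))
  (hd : ∀ E, I E → ¬ IsZero E → ∀ M, I ((sgl d).obj M))
include hI hd

omit ℓ in
/-- In the category `C⟦-d⟧`, the cohomology in degree `d` preserves monomorphisms. -/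
lemma mono_coh_map {X Y : I.FullSubcategory} (f : X ⟶ Y) [Mono f] : Mono ((coh d).map f.hom) := by
  obtain ⟨M, ⟨e⟩⟩ := exists_iso_sgl (hI _ X.property)
  obtain ⟨N, ⟨e'⟩⟩ := exists_iso_sgl (hI _ Y.property)
  obtain ⟨g, hg⟩ := (sgl d).map_surjective (e.inv ≫ f.hom ≫ e'.hom)
  have hf : f.hom = e.hom ≫ (sgl d).map g ≫ e'.inv := by simp [hg]
  have hK : IsZero (kernel g) := by
    by_contra hK
    have hM : ¬ IsZero M := fun h ↦ hK
      ((IsZero.iff_id_eq_zero _).2 ((cancel_mono (kernel.ι g)).1 (h.eq_of_tgt _ _)))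
    have hX : ¬ IsZero X.obj := fun h ↦ hM
      (((sglCohIso d).app M).isZero_iff.1 ((coh d).map_isZero (h.of_iso e.symm)))
    let K : I.FullSubcategory := ⟨(sgl d).obj (kernel g), hd _ X.property hX _⟩
    let u : K ⟶ X := ObjectProperty.homMk ((sgl d).map (kernel.ι g) ≫ e.inv)
    let z : K ⟶ X := ObjectProperty.homMk 0
    have huz : u ≫ f = z ≫ f := by
      apply ObjectProperty.hom_ext
      change ((sgl d).map (kernel.ι g) ≫ e.inv) ≫ f.hom = 0 ≫ f.hom
      rw [hf, zero_comp, Category.assoc, Iso.inv_hom_id_assoc, ← Functor.map_comp_assoc,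
        kernel.condition, Functor.map_zero, zero_comp]
    have h : (sgl d).map (kernel.ι g) ≫ e.inv = 0 :=
      congrArg (fun f ↦ f.hom) ((cancel_mono f).1 huz)
    rw [← zero_comp (f := e.inv), cancel_mono, ← (sgl d).map_zero] at h
    have h := (sgl d).map_injective h
    refine hK ((IsZero.iff_id_eq_zero _).2 ((cancel_mono (kernel.ι g)).1 ?_))
    rw [h, comp_zero, comp_zero]
  have hg : Mono g := Preadditive.mono_of_isZero_kernel g hK
  have : Mono ((coh d).map ((sgl d).map g)) := by
    have h := NatIso.naturality_2 (sglCohIso d) g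
    dsimp at h
    rw [← h]
    infer_instance
  rw [hf, Functor.map_comp, Functor.map_comp]
  infer_instance

include ℓ in
/-- A category of the form `C⟦-d⟧` has finite length, as the length of the cohomology increases
strictly along chains of subobjects. -/
lemma isFiniteLength_fullSubcategory : IsFiniteLength I.FullSubcategory := by
  intro X
  let μ : {S : Subobject X // IsRegularMono S.arrow} → ℕ :=
    fun S ↦ ℓ.len ((coh d).obj (S.1 : I.FullSubcategory).obj)
  have hμ : StrictMono μ := by
    intro S T hST
    let g := Subobject.ofLE S.1 T.1 hST.le
    have := mono_coh_map hI hd g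
    refine lt_of_le_of_ne (ℓ.len_le_of_mono ((coh d).map g.hom)) fun h ↦ ?_
    have : IsIso g.hom := isIso_of_isIso_coh _ fun i ↦ by
      by_cases hi : i = d
      · subst hi
        exact ℓ.isIso_of_mono _ h.ge
      · exact ⟨0, (hI _ (S.1 : I.FullSubcategory).property i hi).eq_of_src _ _,
          (hI _ (T.1 : I.FullSubcategory).property i hi).eq_of_src _ _⟩
    have : IsIso g := (ObjectProperty.isIso_hom_iff g).1 this
    refine hST.not_ge (Subobject.le_of_comm (inv g) ?_)
    rw [IsIso.inv_comp_eq]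
    exact (Subobject.ofLE_arrow hST.le).symm
  have hb (S) : μ S ≤ ℓ.len ((coh d).obj X.obj) := by
    have := mono_coh_map hI hd S.1.arrow
    exact ℓ.len_le_of_mono ((coh d).map S.1.arrow.hom)
  refine ⟨hμ.wellFoundedLT, ?_⟩
  have : StrictAnti fun S ↦ ℓ.len ((coh d).obj X.obj) - μ S := fun S T h ↦ by
    have := hμ h
    have := hb T
    dsimp only
    lia
  exact this.wellFoundedGT

end LocalLength

end LocallyFinite

namespace LocalLength

variable {C : Type u} [Category.{v} C] [Abelian C] [HasDerivedCategory.{w} C] (ℓ : LocalLength C)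

/-- A central charge is determined by its value at the simple object, which is arbitrary. -/
noncomputable def chargeEquiv : (K₀ (DerivedCategory.Bounded C) →+ ℂ) ≃ₗ[ℂ] ℂ where
  toFun Z := Z (K₀.of ℓ.simpleObj)
  map_add' _ _ := rfl
  map_smul' _ _ := rfl
  invFun z := (AddMonoidHom.mulLeft z).comp ((Int.castAddHom ℂ).comp ℓ.eulerHom)
  left_inv Z := K₀.addMonoidHom_ext fun E ↦ by
    rw [ℓ.K₀_of_eq E, map_zsmul, map_zsmul]
    simp [eulerHom_of, euler_simpleObj]
  right_inv z := by simp [eulerHom_of, euler_simpleObj]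

lemma chargeEquiv_apply (Z : K₀ (DerivedCategory.Bounded C) →+ ℂ) :
    ℓ.chargeEquiv Z = Z (K₀.of ℓ.simpleObj) := rfl

lemma chargeEquiv_symm_of (z : ℂ) (E : DerivedCategory.Bounded C) :
    ℓ.chargeEquiv.symm z (K₀.of E) = z * ℓ.euler E := by
  change z * ((ℓ.eulerHom (K₀.of E) : ℤ) : ℂ) = _
  rw [eulerHom_of]

lemma simpleObj_mem_stdSlice (ψ : ℝ) : stdSlice ψ ψ ℓ.simpleObj :=
  stdSlice_of_concentrated (d := 0) (by simp) fun _ ↦ ℓ.isZero_coh_simpleObj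

/-- The standard stability condition with parameter `w`: the simple object is semistable of phase
`Im w / π` and has central charge `exp w`. -/
noncomputable def stdStability (w : ℂ) : StabilityCondition (DerivedCategory.Bounded C) where
  Z := ℓ.chargeEquiv.symm (Complex.exp w)
  P := stdSlice (w.im / Real.pi)
  closedUnderIso _ := inferInstance
  containsZero φ := ⟨_, isZero_zero _, stdSlice_of_isZero _ _ (isZero_zero _)⟩
  closedUnderSums φ := stdSlice_closedUnderSums _ φ
  phase_eq φ E hE hE₀ := by
    obtain ⟨d, hd, hz, hc⟩ := hE.exists_degree hE₀
    refine ⟨Real.exp w.re * ℓ.len ((coh d).obj E), mul_pos (Real.exp_pos _)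
      (Nat.cast_pos.2 (Nat.pos_of_ne_zero fun h ↦ hz (ℓ.isZero_of_len h))), ?_⟩
    have h₁ : (Real.pi * φ * Complex.I : ℂ) = w.im * Complex.I - d * (Real.pi * Complex.I) := by
      rw [eq_sub_of_add_eq hd]
      have : (Real.pi : ℂ) ≠ 0 := by exact_mod_cast Real.pi_ne_zero
      push_cast
      field_simp
    have h₂ : Complex.exp w = Complex.exp w.re * Complex.exp (w.im * Complex.I) := by
      rw [← Complex.exp_add, Complex.re_add_im]
    have h₃ : (((d.negOnePow : ℤ) : ℂ)) * Complex.exp (d * (Real.pi * Complex.I)) = 1 := by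
      rw [Complex.exp_int_mul, Complex.exp_pi_mul_I, Int.cast_negOnePow, ← mul_zpow]
      simp
    rw [chargeEquiv_symm_of, ℓ.euler_of_concentrated hc, h₁, Complex.exp_sub, h₂,
      mul_div_assoc', eq_div_iff (Complex.exp_ne_zero _)]
    push_cast
    linear_combination (Complex.exp w.re * Complex.exp (w.im * Complex.I) *
      ℓ.len ((coh d).obj E)) * h₃
  shift_iff φ E := stdSlice_shift_iff _ φ E
  hom_eq_zero φ₁ φ₂ h E₁ E₂ h₁ h₂ f := stdSlice_hom_eq_zero h h₁ h₂ f
  exists_hn E hE := nonempty_hnFiltration_stdSlice _ hE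

lemma isLocallyFinite_stdStability (w : ℂ) : (ℓ.stdStability w).IsLocallyFinite := by
  -- an open interval of length `1 / 2` contains at most one of the phases `ψ - d`, `d ∈ ℤ`
  refine ⟨1 / 4, by norm_num, by norm_num, fun t ↦ ?_⟩
  set I := (ℓ.stdStability w).interval (t - 1 / 4) (t + 1 / 4)
  have key (E) (hE : I E) (i : ℤ) (hi : ¬ IsZero ((coh i).obj E)) :=
    mem_Ioo_of_extensionClosure hE hi
  by_cases h : ∃ E, I E ∧ ¬ IsZero E
  · obtain ⟨E, hE, hE₀⟩ := h
    obtain ⟨d, hd⟩ := nonempty_cohSupport hE₀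
    have hd := key E hE d hd
    refine ℓ.isFiniteLength_fullSubcategory (d := d) (fun F hF i hi ↦ ?_) fun _ _ _ M ↦ ?_
    · by_contra h
      have h := key F hF i h
      refine hi (Int.cast_injective (α := ℝ) ?_ : i = d)
      rcases lt_trichotomy i d with h' | h' | h'
      · have : (i : ℝ) + 1 ≤ d := by exact_mod_cast h'
        linarith
      · rw [h']
      · have : (d : ℝ) + 1 ≤ i := by exact_mod_cast h'
        linarith
    · exact ExtensionClosure.of _ ⟨_, hd.1, hd.2,
        stdSlice_of_concentrated (sub_add_cancel _ _) (isZero_coh_sgl M d)⟩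
  · push Not at h
    exact ℓ.isFiniteLength_fullSubcategory (d := 0)
      (fun E hE i _ ↦ (coh i).map_isZero (h E hE)) fun E hE hE₀ ↦ (hE₀ (h E hE)).elim

/-- The standard stability conditions, as points of the space of stability conditions. -/
noncomputable def stdStab (w : ℂ) : Stab (DerivedCategory.Bounded C) :=
  ⟨ℓ.stdStability w, ℓ.isLocallyFinite_stdStability w⟩

lemma chargeEquiv_stdStab (w : ℂ) : ℓ.chargeEquiv (ℓ.stdStab w).1.Z = Complex.exp w :=
  ℓ.chargeEquiv.apply_symm_apply _

lemma stdStab_injective : Function.Injective ℓ.stdStab := by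
  intro w w' h
  have hZ : Complex.exp w = Complex.exp w' := by
    rw [← ℓ.chargeEquiv_stdStab w, ← ℓ.chargeEquiv_stdStab w', h]
  have hP : stdSlice (w'.im / Real.pi) (w.im / Real.pi) ℓ.simpleObj := by
    have : (ℓ.stdStab w).1.P (w.im / Real.pi) ℓ.simpleObj := ℓ.simpleObj_mem_stdSlice _
    rw [h] at this
    exact this
  apply Complex.ext
  · have := congrArg norm hZ
    rwa [Complex.norm_exp, Complex.norm_exp, Real.exp_eq_exp] at this
  · obtain ⟨d, hd, hz, -⟩ := hP.exists_degree ℓ.not_isZero_simpleObj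
    obtain rfl : d = 0 := by_contra fun h ↦ hz (ℓ.isZero_coh_simpleObj h)
    rw [Int.cast_zero, add_zero] at hd
    exact (div_left_inj' Real.pi_ne_zero).1 hd

lemma stdStab_surjective : Function.Surjective ℓ.stdStab := by
  intro σ
  obtain ⟨ψ, hψ⟩ := ℓ.exists_eq_stdSlice σ.1
  obtain ⟨m, hm, hZ⟩ := σ.1.phase_eq ψ _ ((hψ _ _).2 (ℓ.simpleObj_mem_stdSlice ψ))
    ℓ.not_isZero_simpleObj
  refine ⟨Real.log m + Real.pi * ψ * Complex.I, Subtype.ext (StabilityCondition.ext ?_ ?_)⟩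
  · apply ℓ.chargeEquiv.injective
    rw [chargeEquiv_stdStab, chargeEquiv_apply, hZ, Complex.exp_add, ← Complex.ofReal_exp,
      Real.exp_log hm]
  · funext φ E
    refine propext (Iff.trans ?_ (hψ φ E).symm)
    have : ((Real.log m + Real.pi * ψ * Complex.I : ℂ)).im / Real.pi = ψ := by
      simp [Real.pi_ne_zero]
    change stdSlice _ φ E ↔ _
    rw [this]

section Metric

variable (w : ℂ) {E : DerivedCategory.Bounded C} (hE : ¬ IsZero E)

lemma exists_phiPlus_eq : ∃ d : ℤ, IsLeast (cohSupport E) d ∧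
    (ℓ.stdStability w).phiPlus E hE + d = w.im / Real.pi :=
  HNFiltration.exists_isLeast ℓ (fun _ _ h ↦ h) ((ℓ.stdStability w).hn E hE)

lemma exists_phiMinus_eq : ∃ d : ℤ, IsGreatest (cohSupport E) d ∧
    (ℓ.stdStability w).phiMinus E hE + d = w.im / Real.pi :=
  HNFiltration.exists_isGreatest ℓ (fun _ _ h ↦ h) ((ℓ.stdStability w).hn E hE)

lemma mass_stdStability : (ℓ.stdStability w).mass E hE = Real.exp w.re * ℓ.totalLen E := by
  let F := (ℓ.stdStability w).hn E hE
  rw [F.totalLen_eq_sum ℓ (ψ := w.im / Real.pi) (fun _ _ h ↦ h), Nat.cast_sum, Finset.mul_sum]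
  refine Finset.sum_congr rfl fun j _ ↦ ?_
  obtain ⟨d, -, -, hd⟩ :=
    stdSlice.exists_degree (ψ := w.im / Real.pi) (F.semistable j) (F.factor_ne_zero j)
  change ‖ℓ.chargeEquiv.symm (Complex.exp w) (K₀.of (F.factor j))‖ = _
  rw [chargeEquiv_symm_of, ℓ.euler_of_concentrated hd, ℓ.totalLen_of_concentrated hd, norm_mul,
    Complex.norm_exp, Complex.norm_intCast]
  simp

end Metric

/-- The generalized metric in terms of the parameters: changing the parameter translates all the
phases and multiplies all the masses by a constant. -/
lemma edist_stdStab (w w' : ℂ) :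
    edist (ℓ.stdStab w) (ℓ.stdStab w') =
      max (edist (w.im / Real.pi) (w'.im / Real.pi)) (edist w.re w'.re) := by
  have key (E : DerivedCategory.Bounded C) (hE : ¬ IsZero E) :
      max (edist ((ℓ.stdStability w).phiMinus E hE) ((ℓ.stdStability w').phiMinus E hE))
        (max (edist ((ℓ.stdStability w).phiPlus E hE) ((ℓ.stdStability w').phiPlus E hE))
          (edist (Real.log ((ℓ.stdStability w).mass E hE))
            (Real.log ((ℓ.stdStability w').mass E hE)))) =
      max (edist (w.im / Real.pi) (w'.im / Real.pi)) (edist w.re w'.re) := by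
    obtain ⟨a, ha, h₁⟩ := ℓ.exists_phiPlus_eq w hE
    obtain ⟨a', ha', h₁'⟩ := ℓ.exists_phiPlus_eq w' hE
    obtain ⟨b, hb, h₂⟩ := ℓ.exists_phiMinus_eq w hE
    obtain ⟨b', hb', h₂'⟩ := ℓ.exists_phiMinus_eq w' hE
    obtain rfl := ha.unique ha'
    obtain rfl := hb.unique hb'
    have e₁ : edist ((ℓ.stdStability w).phiPlus E hE) ((ℓ.stdStability w').phiPlus E hE) =
        edist (w.im / Real.pi) (w'.im / Real.pi) := by rw [← h₁, ← h₁', edist_add_right]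
    have e₂ : edist ((ℓ.stdStability w).phiMinus E hE) ((ℓ.stdStability w').phiMinus E hE) =
        edist (w.im / Real.pi) (w'.im / Real.pi) := by rw [← h₂, ← h₂', edist_add_right]
    have hl : (0 : ℝ) < ℓ.totalLen E := Nat.cast_pos.2 (ℓ.totalLen_pos hE)
    rw [mass_stdStability, mass_stdStability, Real.log_mul (Real.exp_ne_zero _) hl.ne',
      Real.log_mul (Real.exp_ne_zero _) hl.ne', Real.log_exp, Real.log_exp, edist_add_right,
      e₁, e₂, ← max_assoc, max_self]
  refine (iSup_congr fun E ↦ iSup_congr (key E)).trans (le_antisymm (iSup₂_le fun _ _ ↦ le_rfl) ?_)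
  exact le_iSup₂ (f := fun (E : DerivedCategory.Bounded C) (_ : ¬ IsZero E) ↦
    max (edist (w.im / Real.pi) (w'.im / Real.pi)) (edist w.re w'.re))
    ℓ.simpleObj ℓ.not_isZero_simpleObj

end LocalLength

/-! ### The space of stability conditions as a complex manifold -/

section Charts

lemma exists_openPartialHomeomorph_exp (z : ℂ) :
    ∃ e : OpenPartialHomeomorph ℂ ℂ, z ∈ e.source ∧ ⇑e = Complex.exp :=
  ⟨(Complex.hasStrictDerivAt_exp z).hasStrictFDerivAt_equiv (Complex.exp_ne_zero z)
    |>.toOpenPartialHomeomorph Complex.exp,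
    HasStrictFDerivAt.mem_toOpenPartialHomeomorph_source _, rfl⟩

/-- A space homeomorphic to `ℂ` via `Ψ` is a complex manifold with charts the restrictions of
`exp ∘ Ψ` to the open sets on which it is injective, and `Ψ` is then biholomorphic. -/
lemma exists_chartedSpace_exp {M : Type*} [TopologicalSpace M] (Ψ : M ≃ₜ ℂ) :
    ∃ cs : ChartedSpace ℂ M, (∀ e ∈ cs.atlas, ∀ x ∈ e.source, e x = Complex.exp (Ψ x)) ∧
      IsManifold 𝓘(ℂ) ω M ∧
      ∃ Φ : Diffeomorph 𝓘(ℂ) 𝓘(ℂ) M ℂ ω, ∀ x, Φ x = Ψ x := by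
  choose e he₁ he₂ using exists_openPartialHomeomorph_exp
  let c (z : ℂ) : OpenPartialHomeomorph M ℂ := Ψ.transOpenPartialHomeomorph (e z)
  have hc (z : ℂ) (x : M) : c z x = Complex.exp (Ψ x) := congrFun (he₂ z) (Ψ x)
  have hsource (z : ℂ) : (c z).source = Ψ ⁻¹' (e z).source := rfl
  let cs : ChartedSpace ℂ M :=
    { atlas := Set.range c
      chartAt := fun x ↦ c (Ψ x)
      mem_chart_source := fun x ↦ he₁ (Ψ x)
      chart_mem_atlas := fun x ↦ ⟨_, rfl⟩ }
  -- all charts are restrictions of a single map, so that the transition maps are identities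
  have hman : IsManifold 𝓘(ℂ) ω M := by
    refine isManifold_of_contDiffOn _ _ _ ?_
    rintro _ _ ⟨z, rfl⟩ ⟨z', rfl⟩
    refine contDiffOn_id.congr fun y hy ↦ ?_
    have hy : y ∈ (c z).target := hy.1.1
    change c z' ((c z).symm y) = y
    rw [hc, ← hc z, (c z).right_inv hy]
  have hΨ : ContMDiff 𝓘(ℂ) 𝓘(ℂ) ω Ψ := fun x ↦ by
    have h₁ : ContMDiffAt 𝓘(ℂ) 𝓘(ℂ) ω (c (Ψ x)) x :=
      (contMDiffOn_chart (x := x)).contMDiffAt ((c (Ψ x)).open_source.mem_nhds (he₁ (Ψ x)))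
    have h₂ : ContDiffAt ℂ ω (e (Ψ x)).symm (c (Ψ x) x) := by
      have hx : (e (Ψ x)).symm (c (Ψ x) x) = Ψ x := (e (Ψ x)).left_inv (he₁ (Ψ x))
      refine (e (Ψ x)).contDiffAt_symm_deriv (Complex.exp_ne_zero (Ψ x))
        ((e (Ψ x)).map_source (he₁ (Ψ x))) ?_ ?_
      · rw [hx, he₂]
        exact Complex.hasDerivAt_exp _
      · rw [he₂]
        exact Complex.contDiff_exp.contDiffAt
    refine (h₂.contMDiffAt.comp x h₁).congr_of_eventuallyEq ?_
    filter_upwards [(c (Ψ x)).open_source.mem_nhds (he₁ (Ψ x))] with y hy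
    exact ((e (Ψ x)).left_inv hy).symm
  have hΨ' : ContMDiff 𝓘(ℂ) 𝓘(ℂ) ω Ψ.symm := fun z ↦ by
    obtain ⟨x, rfl⟩ := Ψ.surjective z
    have h₁ : ContMDiffAt 𝓘(ℂ) 𝓘(ℂ) ω (c (Ψ x)).symm (Complex.exp (Ψ x)) :=
      (contMDiffOn_chart_symm (x := x)).contMDiffAt
        ((c (Ψ x)).open_target.mem_nhds (hc (Ψ x) x ▸ (c (Ψ x)).map_source (he₁ (Ψ x))))
    refine (h₁.comp (Ψ x) Complex.contDiff_exp.contDiffAt.contMDiffAt).congr_of_eventuallyEq ?_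
    filter_upwards [(e (Ψ x)).open_source.mem_nhds (he₁ (Ψ x))] with y hy
    have hy' : Ψ.symm y ∈ (c (Ψ x)).source := by
      rwa [hsource, Set.mem_preimage, Ψ.apply_symm_apply]
    have := (c (Ψ x)).left_inv hy'
    rw [hc, Ψ.apply_symm_apply] at this
    exact this.symm
  refine ⟨cs, ?_, hman, ⟨Ψ.toEquiv, hΨ, hΨ'⟩, fun _ ↦ rfl⟩
  rintro _ ⟨z, rfl⟩ x -
  exact hc z x

end Charts

namespace LocalLength

variable {C : Type u} [Category.{v} C] [Abelian C] [HasDerivedCategory.{w} C] (ℓ : LocalLength C)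

lemma lipschitzWith_stdStab : LipschitzWith 1 ℓ.stdStab := by
  intro w w'
  rw [ℓ.edist_stdStab, ENNReal.coe_one, one_mul, edist_dist, edist_dist, edist_dist,
    Real.dist_eq, Real.dist_eq, Complex.dist_eq, ← sub_div, abs_div, abs_of_pos Real.pi_pos]
  refine max_le (ENNReal.ofReal_le_ofReal ?_) (ENNReal.ofReal_le_ofReal ?_)
  · rw [← Complex.sub_im]
    refine (div_le_self (abs_nonneg _) ?_).trans (Complex.abs_im_le_norm _)
    linarith [Real.pi_gt_three]
  · rw [← Complex.sub_re]
    exact Complex.abs_re_le_norm _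

lemma antilipschitzWith_stdStab : AntilipschitzWith (1 + NNReal.pi) ℓ.stdStab := by
  intro w w'
  rw [ℓ.edist_stdStab, ENNReal.coe_add, add_mul, ENNReal.coe_one, one_mul]
  have h₁ : edist w w' ≤
      edist w.re w'.re + NNReal.pi * edist (w.im / Real.pi) (w'.im / Real.pi) := by
    rw [edist_dist, edist_dist, edist_dist, ← ENNReal.ofReal_coe_nnreal,
      ← ENNReal.ofReal_mul (NNReal.coe_nonneg _), ← ENNReal.ofReal_add dist_nonneg
      (mul_nonneg (NNReal.coe_nonneg _) dist_nonneg), Complex.dist_eq, Real.dist_eq, Real.dist_eq,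
      NNReal.coe_real_pi, ← sub_div, abs_div, abs_of_pos Real.pi_pos,
      mul_div_cancel₀ _ Real.pi_ne_zero]
    exact ENNReal.ofReal_le_ofReal (Complex.norm_le_abs_re_add_abs_im (w - w'))
  exact h₁.trans (add_le_add (le_max_right _ _) (mul_le_mul_right (le_max_left _ _) _))

/-- The parametrization of the space of stability conditions by `ℂ`. -/
noncomputable def stdHomeomorph : ℂ ≃ₜ Stab (DerivedCategory.Bounded C) where
  toEquiv := Equiv.ofBijective ℓ.stdStab ⟨ℓ.stdStab_injective, ℓ.stdStab_surjective⟩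
  continuous_toFun := ℓ.lipschitzWith_stdStab.continuous
  continuous_invFun := (ℓ.antilipschitzWith_stdStab.to_rightInverse
    (Equiv.ofBijective ℓ.stdStab ⟨ℓ.stdStab_injective, ℓ.stdStab_surjective⟩).right_inv).continuous

lemma exp_stdHomeomorph_symm (σ : Stab (DerivedCategory.Bounded C)) :
    Complex.exp (ℓ.stdHomeomorph.symm σ) = ℓ.chargeEquiv σ.1.Z := by
  rw [← ℓ.chargeEquiv_stdStab]
  congr 3
  exact ℓ.stdHomeomorph.apply_symm_apply σ

end LocalLength

/-! ### Rotations and scalings -/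

section Action

/-- The element of the universal cover of `GL⁺(2, ℝ)` given by the multiplication by `exp c` and
the translation by `Im c / π`. -/
noncomputable def mulExp (c : ℂ) : GLTilde :=
  ⟨⟨(LinearEquiv.smulOfNeZero ℂ ℂ (Complex.exp c) (Complex.exp_ne_zero c)).restrictScalars ℝ,
    OrderIso.addRight (c.im / Real.pi)⟩, by
    refine ⟨?_, fun x ↦ ?_, fun φ ↦ ⟨Real.exp c.re, Real.exp_pos _, ?_⟩⟩
    · change 0 < LinearMap.det (Algebra.lmul ℝ ℂ (Complex.exp c))
      rw [← Algebra.norm_apply, Algebra.norm_complex_apply]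
      exact Complex.normSq_pos.2 (Complex.exp_ne_zero c)
    · change x + 1 + c.im / Real.pi = x + c.im / Real.pi + 1
      ring
    · change Complex.exp c * _ = _ * Complex.exp (Real.pi * (φ + c.im / Real.pi : ℝ) * Complex.I)
      have h : (Real.pi * (φ + c.im / Real.pi : ℝ) * Complex.I : ℂ) =
          Real.pi * φ * Complex.I + c.im * Complex.I := by
        have : (Real.pi : ℂ) ≠ 0 := by exact_mod_cast Real.pi_ne_zero
        push_cast
        field_simp
      have h' : Complex.exp c = Complex.exp c.re * Complex.exp (c.im * Complex.I) := by
        rw [← Complex.exp_add, Complex.re_add_im]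
      rw [h, h', Complex.exp_add, Complex.ofReal_exp]
      ring⟩

lemma mulExp_fst_apply (c z : ℂ) : (mulExp c).1.1 z = Complex.exp c * z := rfl

lemma mulExp_snd_apply (c : ℂ) (x : ℝ) : (mulExp c).1.2 x = x + c.im / Real.pi := rfl

lemma GLTilde_ext {g h : GLTilde} (h₁ : ∀ z, g.1.1 z = h.1.1 z) (h₂ : ∀ x, g.1.2 x = h.1.2 x) :
    g = h :=
  Subtype.ext (Prod.ext (LinearEquiv.ext h₁) (RelIso.ext h₂))

lemma mulExp_add (c c' : ℂ) : mulExp (c + c') = mulExp c * mulExp c' := by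
  refine GLTilde_ext (fun z ↦ ?_) fun x ↦ ?_
  · change Complex.exp (c + c') * z = Complex.exp c * (Complex.exp c' * z)
    rw [Complex.exp_add, mul_assoc]
  · change x + (c + c').im / Real.pi = x + c'.im / Real.pi + c.im / Real.pi
    rw [Complex.add_im]
    ring

lemma mulExp_zero : mulExp 0 = 1 := by
  refine GLTilde_ext (fun z ↦ ?_) fun x ↦ ?_
  · change Complex.exp 0 * z = z
    simp
  · change x + (0 : ℂ).im / Real.pi = x
    simp

lemma mulExp_mem (c : ℂ) : mulExp c ∈ rotationsScalings := by
  rw [← Complex.re_add_im c, mulExp_add]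
  refine mul_mem (Subgroup.subset_closure (Or.inr ⟨Real.exp c.re, Real.exp_pos _, fun z ↦ ?_,
    fun x ↦ ?_⟩)) (Subgroup.subset_closure (Or.inl ⟨c.im / Real.pi, fun z ↦ ?_, fun x ↦ ?_⟩))
  · rw [mulExp_fst_apply, Complex.ofReal_exp]
  · simp [mulExp_snd_apply]
  · have : (Real.pi : ℂ) ≠ 0 := by exact_mod_cast Real.pi_ne_zero
    rw [mulExp_fst_apply]
    push_cast
    rw [mul_div_cancel₀ _ this]
  · simp [mulExp_snd_apply]

/-- The rotations and the scalings generate a copy of the additive group `ℂ`. -/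
lemma exists_eq_mulExp {g : GLTilde} (hg : g ∈ rotationsScalings) : ∃ c, g = mulExp c := by
  induction hg using Subgroup.closure_induction with
  | mem g hg =>
    rcases hg with ⟨θ, h₁, h₂⟩ | ⟨r, hr, h₁, h₂⟩
    · refine ⟨Real.pi * θ * Complex.I, GLTilde_ext (fun z ↦ ?_) fun x ↦ ?_⟩
      · rw [h₁, mulExp_fst_apply]
      · rw [h₂, mulExp_snd_apply]
        simp [Real.pi_ne_zero]
    · refine ⟨Real.log r, GLTilde_ext (fun z ↦ ?_) fun x ↦ ?_⟩
      · rw [h₁, mulExp_fst_apply, ← Complex.ofReal_exp, Real.exp_log hr]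
      · rw [h₂, mulExp_snd_apply]
        simp
  | one => exact ⟨0, mulExp_zero.symm⟩
  | mul a b _ _ ha hb =>
    obtain ⟨c, rfl⟩ := ha
    obtain ⟨c', rfl⟩ := hb
    exact ⟨c + c', (mulExp_add c c').symm⟩
  | inv a _ ha =>
    obtain ⟨c, rfl⟩ := ha
    refine ⟨-c, inv_eq_of_mul_eq_one_right ?_⟩
    rw [← mulExp_add, add_neg_cancel, mulExp_zero]

end Action

namespace LocalLength

variable {C : Type u} [Category.{v} C] [Abelian C] [HasDerivedCategory.{w} C] (ℓ : LocalLength C)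

lemma act_stdStability (w c : ℂ) :
    (ℓ.stdStability w).act (mulExp c) = ℓ.stdStability (w - c) := by
  apply StabilityCondition.ext
  · apply ℓ.chargeEquiv.injective
    change (mulExp c).1.1.symm (ℓ.chargeEquiv (ℓ.stdStab w).1.Z) =
      ℓ.chargeEquiv (ℓ.stdStab (w - c)).1.Z
    rw [chargeEquiv_stdStab, chargeEquiv_stdStab, LinearEquiv.symm_apply_eq, mulExp_fst_apply,
      ← Complex.exp_add, add_sub_cancel]
  · funext φ E
    change stdSlice (w.im / Real.pi) (φ + c.im / Real.pi) E = stdSlice ((w - c).im / Real.pi) φ E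
    refine propext (forall₂_congr fun i _ ↦ ?_)
    rw [Complex.sub_im, sub_div, eq_sub_iff_add_eq, add_right_comm]

lemma smul_stdStab (g : rotationsScalingsᵐᵒᵖ) {c : ℂ} (hg : g.unop.1 = mulExp c) (w : ℂ) :
    g • ℓ.stdStab w = ℓ.stdStab (w - c) := by
  refine Subtype.ext ?_
  change (ℓ.stdStability w).act g.unop.1 = _
  rw [hg, act_stdStability]
  rfl

include ℓ in
lemma exists_smul_eq (σ τ : Stab (DerivedCategory.Bounded C)) :
    ∃ g : rotationsScalingsᵐᵒᵖ, g • σ = τ := by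
  obtain ⟨w, rfl⟩ := ℓ.stdStab_surjective σ
  obtain ⟨w', rfl⟩ := ℓ.stdStab_surjective τ
  refine ⟨MulOpposite.op ⟨mulExp (w - w'), mulExp_mem _⟩, ?_⟩
  rw [ℓ.smul_stdStab _ rfl, sub_sub_cancel]

include ℓ in
lemma eq_one_of_smul_eq {g : rotationsScalingsᵐᵒᵖ} {σ : Stab (DerivedCategory.Bounded C)}
    (h : g • σ = σ) : g = 1 := by
  obtain ⟨w, rfl⟩ := ℓ.stdStab_surjective σ
  obtain ⟨c, hc⟩ := exists_eq_mulExp g.unop.2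
  rw [ℓ.smul_stdStab g hc] at h
  have := ℓ.stdStab_injective h
  obtain rfl : c = 0 := by simpa using this
  rw [mulExp_zero] at hc
  exact MulOpposite.unop_injective (Subtype.ext hc)

end LocalLength

/-! ### Modules of finite length over a local ring -/

section Modules

variable (R : Type u) [CommRing R]

lemma isZero_of_subsingleton {M : FGModuleCat.{u} R} (h : Subsingleton M) :
    IsZero M := by
  rw [IsZero.iff_id_eq_zero]
  ext x
  exact Subsingleton.elim (α := M) _ _

lemma nontrivial_of_not_isZero {M : FGModuleCat.{u} R} (h : ¬ IsZero M) :
    Nontrivial M :=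
  not_subsingleton_iff_nontrivial.1 fun h' ↦ h (isZero_of_subsingleton R h')

variable [IsLocalRing R] [IsArtinianRing R]

/-- Over an artinian local ring, the finitely generated modules form a category of finite length
with the residue field as the only simple object. -/
noncomputable def fgModuleLength : LocalLength (FGModuleCat.{u} R) where
  simple := FGModuleCat.of R (R ⧸ IsLocalRing.maximalIdeal R)
  len M := (Module.length R M).toNat
  len_eq_add {S} hS := by
    have hS' := hS.map_of_exact (forget₂ (FGModuleCat.{u} R) (ModuleCat.{u} R))
    have h := Module.length_eq_add_of_exact
      (S.map (forget₂ (FGModuleCat.{u} R) (ModuleCat.{u} R))).f.hom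
      (S.map (forget₂ (FGModuleCat.{u} R) (ModuleCat.{u} R))).g.hom
      hS'.moduleCat_injective_f hS'.moduleCat_surjective_g
      ((ShortComplex.ShortExact.moduleCat_exact_iff_function_exact _).1 hS'.exact)
    have h : Module.length R S.X₂ = Module.length R S.X₁ + Module.length R S.X₃ := h
    rw [h, ENat.toNat_add Module.length_ne_top Module.length_ne_top]
  isZero_of_len {M} h := by
    rw [ENat.toNat_eq_zero, or_iff_left Module.length_ne_top, Module.length_eq_zero_iff] at h
    exact isZero_of_subsingleton R h
  len_simple := by
    have : IsSimpleModule R (R ⧸ IsLocalRing.maximalIdeal R) :=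
      isSimpleModule_iff_quot_maximal.2 ⟨_, inferInstance, ⟨LinearEquiv.refl _ _⟩⟩
    change (Module.length R (R ⧸ IsLocalRing.maximalIdeal R)).toNat = 1
    rw [Module.length_eq_one]
    rfl
  exists_mono {M} hM := by
    have := nontrivial_of_not_isZero R hM
    obtain ⟨N, hN⟩ := IsAtomic.exists_atom (Submodule R M)
    have := isSimpleModule_iff_isAtom.2 hN
    obtain ⟨I, hI, ⟨e⟩⟩ := isSimpleModule_iff_quot_maximal.1 this
    obtain rfl := IsLocalRing.eq_maximalIdeal hI
    refine ⟨ConcreteCategory.ofHom (N.subtype.comp e.symm.toLinearMap), ?_⟩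
    refine (forget₂ (FGModuleCat.{u} R) (ModuleCat.{u} R)).mono_of_mono_map ?_
    exact (ModuleCat.mono_iff_injective _).2 (N.subtype_injective.comp e.symm.injective)
  exists_epi {M} hM := by
    have := nontrivial_of_not_isZero R hM
    obtain ⟨N, hN⟩ := IsCoatomic.exists_coatom (Submodule R M)
    have := isSimpleModule_iff_isCoatom.2 hN
    obtain ⟨I, hI, ⟨e⟩⟩ := isSimpleModule_iff_quot_maximal.1 this
    obtain rfl := IsLocalRing.eq_maximalIdeal hI
    refine ⟨ConcreteCategory.ofHom (e.toLinearMap.comp N.mkQ), ?_⟩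
    refine (forget₂ (FGModuleCat.{u} R) (ModuleCat.{u} R)).epi_of_epi_map ?_
    exact (ModuleCat.epi_iff_surjective _).2 (e.surjective.comp N.mkQ_surjective)

/-- Finitely generated modules over the dual numbers. -/
noncomputable def dualNumberLength (k : Type u) [Field k] :
    LocalLength (FGModuleCat.{u} (DualNumber k)) :=
  have : Module.Finite k (DualNumber k) := inferInstanceAs (Module.Finite k (k × k))
  have : IsArtinianRing (DualNumber k) := IsArtinianRing.of_finite k (DualNumber k)
  fgModuleLength (DualNumber k)

end Modules

end Bridgeland

theorem mainTheorem2 (k : Type u) [Field k]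
    [HasDerivedCategory.{w} (FGModuleCat.{u} (DualNumber k))] :
    -- `ℂ` is the universal cover of `ℂ*`, via the exponential map
    (SimplyConnectedSpace ℂ ∧
      IsCoveringMap (fun z : ℂ ↦ (⟨Complex.exp z, Complex.exp_ne_zero z⟩ : {z : ℂ // z ≠ 0}))) ∧
    -- the group of rotations and scalings acts freely and transitively on the space
    (Nonempty (Bridgeland.Stab (Bridgeland.DbDual.{w} k)) ∧
      (∀ σ τ : Bridgeland.Stab (Bridgeland.DbDual.{w} k),
        ∃ g : Bridgeland.rotationsScalingsᵐᵒᵖ, g • σ = τ) ∧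
      (∀ (g : Bridgeland.rotationsScalingsᵐᵒᵖ) (σ : Bridgeland.Stab (Bridgeland.DbDual.{w} k)),
        g • σ = σ → g = 1)) ∧
    -- the space is a complex manifold via the central charge, and it is biholomorphic to `ℂ`,
    -- so that the central charge becomes the exponential map
    ∃ (L : (Bridgeland.K₀ (Bridgeland.DbDual.{w} k) →+ ℂ) ≃ₗ[ℂ] ℂ)
      (cs : ChartedSpace ℂ (Bridgeland.Stab (Bridgeland.DbDual.{w} k))),
      Bridgeland.IsCentralChargeAtlas L cs ∧
      IsManifold 𝓘(ℂ) ω (Bridgeland.Stab (Bridgeland.DbDual.{w} k)) ∧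
      ∃ Ψ : Diffeomorph 𝓘(ℂ) 𝓘(ℂ) (Bridgeland.Stab (Bridgeland.DbDual.{w} k)) ℂ ω,
        ∀ σ, Complex.exp (Ψ σ) = L σ.1.Z := by
  let ℓ := Bridgeland.dualNumberLength k
  obtain ⟨cs, hcs, hman, Φ, hΦ⟩ := Bridgeland.exists_chartedSpace_exp ℓ.stdHomeomorph.symm
  refine ⟨⟨inferInstance, Complex.isCoveringMap_exp⟩,
    ⟨⟨ℓ.stdStab 0⟩, ℓ.exists_smul_eq, fun g σ ↦ ℓ.eq_one_of_smul_eq⟩,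
    ℓ.chargeEquiv, cs, fun e he σ hσ ↦ ?_, hman, Φ, fun σ ↦ ?_⟩
  · rw [hcs e he σ hσ, ℓ.exp_stdHomeomorph_symm]
  · rw [hΦ, ℓ.exp_stdHomeomorph_symm]
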